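/- Let $e\ge 3$ be odd and put $b=2^{e-1}$. Let $\Phi(x)\in(\mathbb{Z}/4\mathbb{Z})[x]$ be a monic polynomial which divides $x^{2^e-1}-1$ and whose reduction $\varphi$ modulo $2$ is a primitive polynomial of degree $e$ over $\mathbb{F}_2$. Let $\mathcal{R}=(\mathbb{Z}/4\mathbb{Z})[x]/(\Phi)$ be the Galois ring $\mathrm{GR}(4,e)$, let $K=\mathbb{F}_2[x]/(\varphi)\cong \mathrm{GF}(2^e)$, let $\xi\in\mathcal{R}$ and $\zeta\in K$ be the images of $x$, and put $$\mathcal{T}=\{\xi^j\mid 0\le j\le 2^e-2\},\quad \mathcal{T}_0=\{\xi^j\mid 0\le j\le 2^e-2,\ \mathrm{Tr}_{K/\mathbb{F}_2}(\zeta^j)=0\},\quad \mathcal{P}=2\mathcal{R},\quad \mathcal{P}_0=2\mathcal{T}_0\cup\{0\},\quad H=1+\mathcal{P}_0 .$$ Let $f$ be the automorphism of $\mathcal{R}$ over $\mathbb{Z}/4\mathbb{Z}$ with $\xi^f=\xi^2$, let $\mathcal{S}(\alpha)=\sum_{k=0}^{e-1}\alpha^{f^k}\in\mathbb{Z}/4\mathbb{Z}$,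 let $\chi(\alpha)=i^{e\mathcal{S}(\alpha)}$ with $i=\sqrt{-1}$, and for $\alpha\in\mathcal{R}$, $A\subset\mathcal{R}$ put $\lambda_\alpha(A)=\sum_{\beta\in A}\chi(\alpha\beta)$. Define $$S_0=\{0\},\quad S_1=(\mathcal{T}\setminus\{1\})H,\quad S_2=(\mathcal{T}\setminus\{1\})(-H),\quad S_3=H,\quad S_4=-H,\quad S_5=\mathcal{P}_0\setminus\{0\},\quad S_6=\mathcal{P}\setminus\mathcal{P}_0 .$$ Then for all $i,j\in\{0,\dots,6\}$ the value $\lambda_\alpha(S_j)$ is the same for all $\alpha\in S_i$, namely the $(i,j)$ entry $p_{i,j}$ (rows and columns numbered from $0$) of $$P=\begin{pmatrix} 1&2b(b-1)&2b(b-1)&b&b&b-1&b\\ 1&bi&-bi&0&0&-1&0\\ 1&-bi&bi&0&0&-1&0\\ 1&0&0&bi&-bi&b-1&-b \\ 1&0&0&-bi&bi&b-1&-b \\ 1&-2b&-2b&b&b&b-1&b \\ 1&0&0&-b&-b&b-1&b \end{pmatrix}.$$ Moreover, with $R_j=\{(\alpha,\beta)\in\mathcal{R}\times\mathcal{R}\mid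 \alpha-\beta\in S_j\}$, the pair $(\mathcal{R},\{R_j\}_{j=0}^6)$ is a commutative nonsymmetric association scheme of class $6$ with first eigenmatrix $P$; that is, the primitive idempotents of its Bose–Mesner algebra can be numbered $E_0=|\mathcal{R}|^{-1}J,E_1,\dots,E_6$, where $J$ is the all-ones matrix, so that the adjacency matrices are $A_j=\sum_{i=0}^6 p_{i,j}E_i$ for $j=0,\dots,6$. -/

import Mathlib

open Polynomial
open scoped Pointwise

/-! ## Association schemes -/

/-- `(X, {R_i}_{0 ≤ i ≤ d})` is a commutative association scheme of class `d`: the `R_i` are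
nonempty and partition `X × X`, `R_0` is the diagonal, the transpose of each `R_i` is some `R_{i'}`,
the intersection numbers `p_{ij}^k` are well defined, and `p_{ij}^k = p_{ji}^k`. -/
structure IsCommAssociationScheme {X : Type*} [Fintype X] (d : ℕ)
    (R : Fin (d + 1) → Set (X × X)) : Prop where
  diagonal : R 0 = {q | q.1 = q.2}
  nonempty : ∀ i, (R i).Nonempty
  disjoint : ∀ i j, i ≠ j → Disjoint (R i) (R j)
  cover : ⋃ i, R i = Set.univ
  transpose : ∀ i, ∃ i', R i' = {q | (q.2, q.1) ∈ R i}
  intersectionNumbers : ∃ p : Fin (d + 1) → Fin (d + 1) → Fin (d + 1) → ℕ,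
    (∀ i j k, ∀ x y : X, (x, y) ∈ R k →
      {z : X | (x, z) ∈ R i ∧ (z, y) ∈ R j}.ncard = p i j k) ∧
    ∀ i j k, p i j k = p j i k

/-- All relations of the scheme are symmetric. -/
def IsSymmetricScheme {X : Type*} {d : ℕ} (R : Fin (d + 1) → Set (X × X)) : Prop :=
  ∀ i, ∀ x y : X, (x, y) ∈ R i → (y, x) ∈ R i

open Classical in
/-- The adjacency matrix of a relation. -/
noncomputable def relAdjMatrix {X : Type*} (r : Set (X × X)) : Matrix X X ℂ :=
  Matrix.of fun x y => if (x, y) ∈ r then 1 else 0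

/-- The linear span of the adjacency matrices (the Bose–Mesner algebra, for a scheme). -/
noncomputable def boseMesner {X : Type*} {d : ℕ} (R : Fin (d + 1) → Set (X × X)) :
    Submodule ℂ (Matrix X X ℂ) :=
  Submodule.span ℂ (Set.range fun i => relAdjMatrix (R i))

/-- `E` is a primitive idempotent of (the commutative algebra) `𝔄`. -/
def IsPrimitiveIdempotentOf {X : Type*} [Fintype X] (𝔄 : Submodule ℂ (Matrix X X ℂ))
    (E : Matrix X X ℂ) : Prop :=
  E ∈ 𝔄 ∧ E ≠ 0 ∧ E * E = E ∧
    ∀ F ∈ 𝔄, F * F = F → E * F = F → F * E = F → F = 0 ∨ F = E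

/-- `P` is the first eigenmatrix of the scheme with respect to some numbering
`E_0 = |X|⁻¹ J, E_1, …, E_d` of the primitive idempotents of the Bose–Mesner algebra:
`A_j = ∑ i, P i j • E_i`. -/
def IsFirstEigenmatrix {X : Type*} [Fintype X] {d : ℕ} (R : Fin (d + 1) → Set (X × X))
    (P : Matrix (Fin (d + 1)) (Fin (d + 1)) ℂ) : Prop :=
  ∃ E : Fin (d + 1) → Matrix X X ℂ,
    Function.Injective E ∧
    Set.range E = {F | IsPrimitiveIdempotentOf (boseMesner R) F} ∧
    E 0 = (Fintype.card X : ℂ)⁻¹ • Matrix.of (fun _ _ => 1) ∧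
    ∀ j, relAdjMatrix (R j) = ∑ i, P i j • E i

/-! ## Galois rings of characteristic four -/

/-- Primitive polynomials over a finite field `F` with `q` elements: monic irreducible polynomials
`φ` whose root in `F[x]/(φ)` has multiplicative order `q ^ deg φ - 1`. -/
def IsPrimitivePoly {F : Type*} [Field F] (φ : F[X]) : Prop :=
  φ.Monic ∧ Irreducible φ ∧ orderOf (AdjoinRoot.root φ) = Nat.card F ^ φ.natDegree - 1

/-- Reduction modulo two. -/
def redTwo : ZMod 4 →+* ZMod 2 := ZMod.castHom (by norm_num) (ZMod 2)

/-- The polynomials `Φ` over `ℤ/4ℤ` that present the Galois ring `GR(4, e)`: monic, with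
primitive reduction of degree `e` modulo two, and dividing `x ^ (2 ^ e - 1) - 1`. -/
structure GaloisPoly (e : ℕ) where
  poly : (ZMod 4)[X]
  monic : poly.Monic
  primitive : IsPrimitivePoly (poly.map redTwo)
  degree : (poly.map redTwo).natDegree = e
  dvd : poly ∣ X ^ (2 ^ e - 1) - 1

namespace GaloisPoly

variable {e : ℕ} (Φ : GaloisPoly e)

/-- The Galois ring `(ℤ/4ℤ)[x]/(Φ)`. -/
abbrev Ring : Type := AdjoinRoot Φ.poly

/-- The field `K = 𝔽₂[x]/(φ)`, where `φ` is the reduction of `Φ` modulo two. -/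
abbrev Res : Type := AdjoinRoot (Φ.poly.map redTwo)

/-- The image `ξ` of `x` in the Galois ring. -/
noncomputable def ξ : Φ.Ring := AdjoinRoot.root Φ.poly

/-- The root `ζ` of `φ` in `K`. -/
noncomputable def ζ : Φ.Res := AdjoinRoot.root (Φ.poly.map redTwo)

instance finite_ring : Finite Φ.Ring := by
  have := Φ.monic.finite_adjoinRoot
  exact Module.finite_of_finite (ZMod 4)

noncomputable instance fintype_ring : Fintype Φ.Ring := Fintype.ofFinite _

/-! ### The Frobenius automorphism -/

theorem redTwo_eq_zero : ∀ a : ZMod 4, redTwo a = 0 → ∃ b : ZMod 4, a = 2 * b := by decide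

theorem redTwo_two_mul : ∀ a : ZMod 4, 2 * a = 0 → redTwo a = 0 := by decide

theorem redTwo_surjective : Function.Surjective redTwo := by decide

theorem four_eq_zero : (4 : (ZMod 4)[X]) = 0 := by
  have h : (4 : ZMod 4) = 0 := by decide
  calc (4 : (ZMod 4)[X]) = C (4 : ZMod 4) := (map_ofNat C 4).symm
    _ = 0 := by rw [h, C_0]

theorem map_eq_zero_of (p : (ZMod 4)[X]) (h : p.map redTwo = 0) : ∃ q, p = 2 * q := by
  have h1 : ∀ a : ZMod 4, ∃ b : ZMod 4, redTwo a = 0 → a = 2 * b := fun a => by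
    by_cases ha : redTwo a = 0
    · obtain ⟨b, hb⟩ := redTwo_eq_zero a ha
      exact ⟨b, fun _ => hb⟩
    · exact ⟨0, fun h => absurd h ha⟩
  choose g hg using h1
  refine ⟨∑ i ∈ p.support, monomial i (g (p.coeff i)), ?_⟩
  rw [Finset.mul_sum]
  conv_lhs => rw [p.as_sum_support]
  refine Finset.sum_congr rfl fun i _ => ?_
  have : redTwo (p.coeff i) = 0 := by rw [← coeff_map, h, coeff_zero]
  conv_lhs => rw [hg _ this]
  rw [show (2 : (ZMod 4)[X]) = C 2 from (map_ofNat C 2).symm, C_mul_monomial]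

theorem map_eq_zero_of_two_mul (p : (ZMod 4)[X]) (h : 2 * p = 0) : p.map redTwo = 0 := by
  ext i
  rw [coeff_map, coeff_zero]
  apply redTwo_two_mul
  rw [← coeff_C_mul, show (C 2 : (ZMod 4)[X]) = 2 from map_ofNat C 2, h, coeff_zero]

theorem two_mul_two (x : Φ.Ring) : 2 * (2 * x) = 0 := by
  have h : (4 : Φ.Ring) = 0 := by
    have := congrArg (AdjoinRoot.mk Φ.poly) four_eq_zero
    rwa [map_ofNat, map_zero] at this
  linear_combination x * h

/-- If `2 z = 0` then `z ∈ 2 R`. -/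
theorem eq_two_mul_of_two_mul (z : Φ.Ring) (h : 2 * z = 0) : ∃ y, z = 2 * y := by
  obtain ⟨p, rfl⟩ := AdjoinRoot.mk_surjective z
  have h2 : AdjoinRoot.mk Φ.poly (2 * p) = 0 := by rw [map_mul, map_ofNat]; exact h
  obtain ⟨q, hq⟩ := AdjoinRoot.mk_eq_zero.mp h2
  have h3 : (Φ.poly.map redTwo) * q.map redTwo = 0 := by
    rw [← Polynomial.map_mul, ← hq]
    have : (2 : (ZMod 2)[X]) = 0 := by
      rw [show (2 : (ZMod 2)[X]) = C 2 from (map_ofNat C 2).symm, show (2 : ZMod 2) = 0 by decide, C_0]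
    simp [this]
  have h4 : q.map redTwo = 0 :=
    (mul_eq_zero.mp h3).resolve_left Φ.primitive.1.ne_zero
  obtain ⟨q', rfl⟩ := map_eq_zero_of q h4
  have h5 : 2 * (p - Φ.poly * q') = 0 := by linear_combination hq
  obtain ⟨r, hr⟩ := map_eq_zero_of _ (map_eq_zero_of_two_mul _ h5)
  refine ⟨AdjoinRoot.mk Φ.poly r, ?_⟩
  have := congrArg (AdjoinRoot.mk Φ.poly) hr
  simp only [map_sub, map_mul, map_ofNat, AdjoinRoot.mk_self, zero_mul, sub_zero] at this
  exact this

theorem aeval_ξ (p : (ZMod 4)[X]) : aeval Φ.ξ p = AdjoinRoot.mk Φ.poly p :=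
  AdjoinRoot.aeval_eq p

theorem ξ_pow_sub_one : Φ.ξ ^ (2 ^ e - 1) = 1 := by
  have h := AdjoinRoot.mk_eq_zero.mpr Φ.dvd
  rw [map_sub, map_pow, AdjoinRoot.mk_X, map_one, sub_eq_zero] at h
  exact h

theorem ξ_pow : Φ.ξ ^ 2 ^ e = Φ.ξ := by
  have h : 2 ^ e = (2 ^ e - 1) + 1 := (Nat.sub_add_cancel Nat.one_le_two_pow).symm
  rw [h, pow_succ, ξ_pow_sub_one, one_mul]

/-- `p(x²) ≡ p(x)²` modulo two. -/
theorem aeval_ξ_sq (p : (ZMod 4)[X]) : ∃ y, aeval (Φ.ξ ^ 2) p = (aeval Φ.ξ p) ^ 2 + 2 * y := by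
  have h : (expand (ZMod 4) 2 p - p ^ 2).map redTwo = 0 := by
    rw [Polynomial.map_sub, Polynomial.map_pow, map_expand, ZMod.expand_card, sub_self]
  obtain ⟨q, hq⟩ := map_eq_zero_of _ h
  refine ⟨aeval Φ.ξ q, ?_⟩
  have := congrArg (aeval Φ.ξ) hq
  rw [map_sub, map_pow, expand_aeval, map_mul] at this
  rw [map_ofNat] at this
  linear_combination this

/-- `ξ²` is a root of `Φ`. -/
theorem aeval_ξ_sq_poly : aeval (Φ.ξ ^ 2) Φ.poly = 0 := by
  obtain ⟨Ψ, hΨ⟩ := Φ.dvd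
  have hpos : e ≠ 0 := by
    rw [← Φ.degree]
    exact Φ.primitive.2.1.natDegree_pos.ne'
  have hn : ((2 ^ e - 1 : ℕ) : ZMod 2) ≠ 0 := by
    rw [Nat.cast_sub Nat.one_le_two_pow]
    push_cast
    rw [show (2 : ZMod 2) = 0 by decide, zero_pow hpos]
    decide
  have hsep : (X ^ (2 ^ e - 1) - 1 : (ZMod 2)[X]).Separable := by
    have := separable_X_pow_sub_C (1 : ZMod 2) hn one_ne_zero
    simpa using this
  have hΨ2 : (X ^ (2 ^ e - 1) - 1 : (ZMod 2)[X]) = Φ.poly.map redTwo * Ψ.map redTwo := by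
    rw [← Polynomial.map_mul, ← hΨ]; simp
  rw [hΨ2] at hsep
  obtain ⟨a, b, hab⟩ := hsep.isCoprime
  obtain ⟨a, rfl⟩ := Polynomial.map_surjective redTwo redTwo_surjective a
  obtain ⟨b, rfl⟩ := Polynomial.map_surjective redTwo redTwo_surjective b
  obtain ⟨c, hc⟩ := map_eq_zero_of (a * Φ.poly + b * Ψ - 1) (by
    simp only [Polynomial.map_sub, Polynomial.map_add, Polynomial.map_mul, Polynomial.map_one]
    rw [hab, sub_self])
  obtain ⟨y, hy⟩ := Φ.aeval_ξ_sq Φ.poly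
  have h0 : aeval Φ.ξ Φ.poly = 0 := by rw [aeval_ξ, AdjoinRoot.mk_self]
  rw [h0] at hy
  have hc' := congrArg (aeval (Φ.ξ ^ 2)) hc
  simp only [map_sub, map_add, map_mul, map_one, map_ofNat] at hc'
  have hprod := congrArg (aeval (Φ.ξ ^ 2)) hΨ
  simp only [map_sub, map_pow, map_mul, map_one, aeval_X] at hprod
  rw [← pow_mul, mul_comm 2, pow_mul, Φ.ξ_pow_sub_one, one_pow, sub_self] at hprod
  set u := aeval (Φ.ξ ^ 2) Φ.poly
  set v := aeval (Φ.ξ ^ 2) Ψ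
  set A := aeval (Φ.ξ ^ 2) a
  set B := aeval (Φ.ξ ^ 2) b
  set D := aeval (Φ.ξ ^ 2) c
  have e1 : u * u = 0 := by
    rw [hy]; linear_combination Φ.two_mul_two (y * y)
  have e2 : 2 * u = 0 := by
    rw [hy]; linear_combination Φ.two_mul_two y
  linear_combination (-u) * hc' + A * e1 - B * hprod - D * e2

/-- The endomorphism of the Galois ring over `ℤ/4ℤ` with `ξ ↦ ξ²`. -/
noncomputable def frobHom : Φ.Ring →ₐ[ZMod 4] Φ.Ring :=
  AdjoinRoot.liftAlgHom Φ.poly (Algebra.ofId (ZMod 4) Φ.Ring) (Φ.ξ ^ 2) Φ.aeval_ξ_sq_poly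

theorem frobHom_ξ : Φ.frobHom Φ.ξ = Φ.ξ ^ 2 := by
  simp [frobHom, ξ]

theorem frobHom_aeval (p : (ZMod 4)[X]) : Φ.frobHom (aeval Φ.ξ p) = aeval (Φ.ξ ^ 2) p := by
  rw [← frobHom_ξ, aeval_algHom_apply]

theorem frobHom_iterate (α : Φ.Ring) : Φ.frobHom^[e] α = α := by
  have h : ∀ k, ∀ p : (ZMod 4)[X],
      Φ.frobHom^[k] (aeval Φ.ξ p) = aeval (Φ.ξ ^ 2 ^ k) p := by
    intro k
    induction k with
    | zero => intro p; simp
    | succ k ih =>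
      intro p
      rw [Function.iterate_succ_apply', ih, ← aeval_algHom_apply, map_pow, frobHom_ξ,
        ← pow_mul, pow_succ']
  obtain ⟨p, rfl⟩ := AdjoinRoot.mk_surjective α
  rw [← aeval_ξ, h, ξ_pow]

theorem frobHom_bijective : Function.Bijective Φ.frobHom := by
  rw [← Finite.injective_iff_bijective]
  have hpos : 0 < e := by
    rw [← Φ.degree]
    exact Φ.primitive.2.1.natDegree_pos
  obtain ⟨k, rfl⟩ : ∃ k, e = k + 1 := ⟨e - 1, by omega⟩
  intro x y hxy
  rw [← Φ.frobHom_iterate x, ← Φ.frobHom_iterate y, Function.iterate_succ_apply,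
    Function.iterate_succ_apply, hxy]

/-- The Frobenius automorphism `f` of the Galois ring: it fixes `ℤ/4ℤ` and sends `ξ` to `ξ²`. -/
noncomputable def frob : Φ.Ring ≃ₐ[ZMod 4] Φ.Ring :=
  AlgEquiv.ofBijective Φ.frobHom Φ.frobHom_bijective

/-! ### The trace -/

/-- `α + α^f + ⋯ + α^(f^(e-1))`, as an element of the Galois ring. -/
noncomputable def frobSum (α : Φ.Ring) : Φ.Ring := ∑ k ∈ Finset.range e, Φ.frob^[k] α

theorem frob_frobSum (α : Φ.Ring) : Φ.frob (Φ.frobSum α) = Φ.frobSum α := by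
  have h : Φ.frob^[e] α = α := Φ.frobHom_iterate α
  have h1 := Finset.sum_range_succ (fun k => Φ.frob^[k] α) e
  rw [Finset.sum_range_succ', h] at h1
  simp only [Function.iterate_zero_apply] at h1
  have h2 := add_right_cancel h1
  rw [frobSum, map_sum, ← h2]
  exact Finset.sum_congr rfl fun k _ => (Function.iterate_succ_apply' _ _ _).symm

/-- If `x^f ≡ x` modulo two then `x` is congruent modulo two to an element of `ℤ/4ℤ`. -/
theorem exists_of_frob_sub (x y : Φ.Ring) (h : Φ.frob x - x = 2 * y) :
    ∃ (a : ZMod 4) (z : Φ.Ring), x = algebraMap (ZMod 4) Φ.Ring a + 2 * z := by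
  obtain ⟨p, rfl⟩ := AdjoinRoot.mk_surjective x
  obtain ⟨r, rfl⟩ := AdjoinRoot.mk_surjective y
  obtain ⟨w, hw⟩ := Φ.aeval_ξ_sq p
  obtain ⟨s, rfl⟩ := AdjoinRoot.mk_surjective w
  have h1 : Φ.frob (AdjoinRoot.mk Φ.poly p) = aeval (Φ.ξ ^ 2) p := by
    rw [← aeval_ξ]; exact Φ.frobHom_aeval p
  rw [h1, hw, aeval_ξ] at h
  have h2 : AdjoinRoot.mk Φ.poly (p ^ 2 - p - 2 * (r - s)) = 0 := by
    simp only [map_sub, map_mul, map_pow, map_ofNat]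
    linear_combination h
  have h3 := Polynomial.map_dvd redTwo (AdjoinRoot.mk_eq_zero.mp h2)
  have htwo : (2 : (ZMod 2)[X]) = 0 := by
    rw [show (2 : (ZMod 2)[X]) = C 2 from (map_ofNat C 2).symm, show (2 : ZMod 2) = 0 by decide, C_0]
  have h4 : Φ.poly.map redTwo ∣ p.map redTwo * (p.map redTwo - 1) := by
    convert h3 using 1
    simp only [Polynomial.map_sub, Polynomial.map_mul, Polynomial.map_pow, Polynomial.map_ofNat,
      htwo]
    ring
  have key : ∀ a : ZMod 4, Φ.poly.map redTwo ∣ p.map redTwo - C (redTwo a) →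
      ∃ z : Φ.Ring, AdjoinRoot.mk Φ.poly p = algebraMap (ZMod 4) Φ.Ring a + 2 * z := by
    rintro a ⟨q, hq⟩
    obtain ⟨q, rfl⟩ := Polynomial.map_surjective redTwo redTwo_surjective q
    obtain ⟨t, ht⟩ := map_eq_zero_of (p - C a - Φ.poly * q) (by
      simp only [Polynomial.map_sub, Polynomial.map_mul, Polynomial.map_C]
      rw [hq, sub_self])
    refine ⟨AdjoinRoot.mk Φ.poly t, ?_⟩
    have := congrArg (AdjoinRoot.mk Φ.poly) ht
    simp only [map_sub, map_mul, AdjoinRoot.mk_self, zero_mul, sub_zero, AdjoinRoot.mk_C,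
      map_ofNat] at this
    rw [AdjoinRoot.algebraMap_eq]
    linear_combination this
  rcases Φ.primitive.2.1.prime.dvd_or_dvd h4 with h5 | h5
  · exact ⟨0, key 0 (by simpa using h5)⟩
  · exact ⟨1, key 1 (by simpa using h5)⟩

/-- `frobSum` takes values in `ℤ/4ℤ`. -/
theorem exists_trace (α : Φ.Ring) :
    ∃ a : ZMod 4, algebraMap (ZMod 4) Φ.Ring a = Φ.frobSum α := by
  have hx := Φ.frob_frobSum α
  generalize Φ.frobSum α = x at hx
  obtain ⟨a, z, rfl⟩ := Φ.exists_of_frob_sub x 0 (by rw [hx]; ring)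
  have h2 : 2 * (Φ.frob z - z) = 0 := by
    simp only [map_add, map_mul, map_ofNat, AlgEquiv.commutes] at hx
    linear_combination hx
  obtain ⟨y, hy⟩ := Φ.eq_two_mul_of_two_mul _ h2
  obtain ⟨c, w, rfl⟩ := Φ.exists_of_frob_sub z y hy
  refine ⟨a + 2 * c, ?_⟩
  simp only [map_add, map_mul, map_ofNat]
  linear_combination -Φ.two_mul_two w

/-- The trace `𝒮 : R → ℤ/4ℤ`, `𝒮(α) = α + α^f + ⋯ + α^(f^(e-1))`. -/
noncomputable def trace (α : Φ.Ring) : ZMod 4 := Classical.choose (Φ.exists_trace α)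

theorem algebraMap_trace (α : Φ.Ring) :
    algebraMap (ZMod 4) Φ.Ring (Φ.trace α) = ∑ k ∈ Finset.range e, Φ.frob^[k] α :=
  Classical.choose_spec (Φ.exists_trace α)

/-! ### Characters and the sets `S_0, …, S_6` -/

/-- The additive character `χ(α) = i ^ (e 𝒮(α))`. -/
noncomputable def χ (α : Φ.Ring) : ℂ := Complex.I ^ (e * (Φ.trace α).val)

open Classical in
/-- `λ_α(A) = ∑_{β ∈ A} χ(αβ)`. -/
noncomputable def charSum (α : Φ.Ring) (A : Set Φ.Ring) : ℂ :=
  ∑ β : Φ.Ring with β ∈ A, Φ.χ (α * β)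

/-- The cyclic group `𝒯` generated by `ξ`. -/
def T : Set Φ.Ring := {x | ∃ j : ℕ, j ≤ 2 ^ e - 2 ∧ x = Φ.ξ ^ j}

/-- `𝒯_δ`, the set of `ξ^j` with `Tr(ζ^j) = δ`. -/
def Tδ (δ : ZMod 2) : Set Φ.Ring :=
  {x | ∃ j : ℕ, j ≤ 2 ^ e - 2 ∧ Algebra.trace (ZMod 2) Φ.Res (Φ.ζ ^ j) = δ ∧ x = Φ.ξ ^ j}

/-- The maximal ideal `𝒫 = 2R`. -/
def P : Set Φ.Ring := {x | ∃ y, x = 2 * y}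

/-- `𝒫_0 = 2 𝒯_0 ∪ {0}`. -/
def P₀ : Set Φ.Ring := {x | ∃ t ∈ Φ.Tδ 0, x = 2 * t} ∪ {0}

/-- `H = 1 + 𝒫_0`. -/
def H : Set Φ.Ring := {x | ∃ y ∈ Φ.P₀, x = 1 + y}

/-- The sets `S_0, …, S_6`; products and negatives of sets are elementwise. -/
def S : Fin 7 → Set Φ.Ring :=
  ![{0},
    (Φ.T \ {1}) * Φ.H,
    (Φ.T \ {1}) * (-Φ.H),
    Φ.H,
    -Φ.H,
    Φ.P₀ \ {0},
    Φ.P \ Φ.P₀]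

/-- The relation `R_j`: pairs `(α, β)` with `α - β ∈ S_j`. -/
def rel (j : Fin 7) : Set (Φ.Ring × Φ.Ring) := {q | q.1 - q.2 ∈ Φ.S j}

end GaloisPoly

open Complex in
/-- The `7 × 7` eigenmatrix with parameter `b`. -/
noncomputable def eigenmatrixSix (b : ℂ) : Matrix (Fin 7) (Fin 7) ℂ :=
  !![1, 2 * b * (b - 1), 2 * b * (b - 1), b, b, b - 1, b;
     1, b * I, -(b * I), 0, 0, -1, 0;
     1, -(b * I), b * I, 0, 0, -1, 0;
     1, 0, 0, b * I, -(b * I), b - 1, -b;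
     1, 0, 0, -(b * I), b * I, b - 1, -b;
     1, -(2 * b), -(2 * b), b, b, b - 1, b;
     1, 0, 0, -b, -b, b - 1, b]

/-!
# A self-dual translation scheme of class six on the Galois ring `GR(4, e)`

The proof rests on two facts: the character `χ` is primitive (`GaloisPoly.addChar_isPrimitive`), and
the character sums over the blocks `S_j` are constant on the *same* blocks
(`GaloisPoly.charSum_eq_eigenmatrixSix`). The rest is formal. By primitivity the characters
`x ↦ χ (α x)` are pairwise orthogonal, so grouping their rank-one idempotents according to the block
of `α` gives orthogonal idempotents `E_i`. Fourier inversion writes the adjacency matrices as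
`A_j = ∑ i, P i j • E_i`, and evaluating the entries of `E_i`, which are again character sums over
`S_i`, writes each `E_i` as a combination of the `A_j`. Hence the span of the `A_j` is the span of
the `E_i`: it is closed under multiplication, it is commutative, and its primitive idempotents are
the `E_i`. Constancy of the entries of `A_i * A_j` on each relation yields the intersection numbers.

For the character sums, write `K` for the residue field and `Tr` for its trace over `𝔽₂`. Every
element of the ring is either `2 x` or `t (1 + 2 x)`, with `x ∈ K` and `t` a Teichmüller
representative; both are well defined because `2 x` depends only on `x` modulo two. As `e` is odd,
`Tr 1 = 1`, so that `H` and `-H` are the sets of `1 + 2 x` with `Tr x = 0` and `Tr x = 1`;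
moreover `χ (2 x) = (-1) ^ Tr x` and `χ 1 = i ^ (e ^ 2) = i`. Thus
`λ_α (±H) = χ α * ∑ (-1) ^ Tr (a x)`, where `a` is the residue of `α` and the sum is over the `x`
with `Tr x` equal to `0` or `1`. This sum vanishes unless `a` is `0` or `1`
(`GaloisPoly.sum_sgn_resTrace_fiber`), and it is `± 2 ^ (e - 1)` in these two cases. Summing over
the Teichmüller representatives different from `1` leaves at most one term if `α` is a unit, and a
full character sum over `K` with two terms removed if `α ∈ 2 R`; no Gauss sum is needed.

That the blocks are nonempty and disjoint can be read off from the table of character sums: the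
entries of its first row are nonzero and its rows are distinct.
-/

/-! ### Self-dual translation schemes on a finite ring -/

/-- The `(x, y)` entry of a product of adjacency matrices counts paths of length two. -/
theorem relAdjMatrix_mul_apply {X : Type*} [Fintype X] (r s : Set (X × X)) (x y : X) :
    (relAdjMatrix r * relAdjMatrix s) x y =
      ({z : X | (x, z) ∈ r ∧ (z, y) ∈ s}.ncard : ℂ) := by
  classical
  rw [Set.ncard_eq_toFinset_card', Matrix.mul_apply]
  simp only [relAdjMatrix, Matrix.of_apply, mul_ite, mul_one, mul_zero, ← ite_and]
  rw [Finset.sum_boole]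
  congr 2
  ext z
  simp [and_comm]

section TranslationScheme

variable {R : Type*} [CommRing R] [Fintype R]

/-- The rank-one idempotent attached to the character `x ↦ ψ (α x)`; its `(x, y)` entry is
`|R|⁻¹ ψ (α (y - x))`. -/
noncomputable def charIdempotent (ψ : AddChar R ℂ) (α : R) : Matrix R R ℂ :=
  Matrix.of fun x y => (Fintype.card R : ℂ)⁻¹ * ψ (α * (y - x))

theorem card_ne_zero_complex : (Fintype.card R : ℂ) ≠ 0 :=
  Nat.cast_ne_zero.mpr Fintype.card_ne_zero

open Classical in
theorem charIdempotent_mul {ψ : AddChar R ℂ} (hψ : ψ.IsPrimitive) (α β : R) :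
    charIdempotent ψ α * charIdempotent ψ β = if α = β then charIdempotent ψ α else 0 := by
  ext x y
  have h := AddChar.sum_mulShift (α - β) hψ
  have hterm : ∀ z, charIdempotent ψ α x z * charIdempotent ψ β z y =
      (Fintype.card R : ℂ)⁻¹ * (Fintype.card R : ℂ)⁻¹ * ψ (β * y - α * x) *
        ψ (z * (α - β)) := by
    intro z
    have : ψ (α * (z - x)) * ψ (β * (y - z)) = ψ (β * y - α * x) * ψ (z * (α - β)) := by
      rw [← AddChar.map_add_eq_mul, ← AddChar.map_add_eq_mul]
      congr 1
      ring
    simp only [charIdempotent, Matrix.of_apply]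
    linear_combination (Fintype.card R : ℂ)⁻¹ * (Fintype.card R : ℂ)⁻¹ * this
  rw [Matrix.mul_apply, Finset.sum_congr rfl fun z _ => hterm z, ← Finset.mul_sum, h]
  by_cases hαβ : α = β
  · subst hαβ
    have hc := card_ne_zero_complex (R := R)
    simp only [sub_self, if_true, charIdempotent, Matrix.of_apply, mul_sub]
    field_simp
  · rw [if_neg (sub_ne_zero.mpr hαβ), if_neg hαβ]
    simp

open Classical in
/-- The sum of the idempotents attached to the characters indexed by `A`. -/
noncomputable def charProjection (ψ : AddChar R ℂ) (A : Set R) : Matrix R R ℂ :=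
  ∑ α : R with α ∈ A, charIdempotent ψ α

theorem charProjection_mul_self {ψ : AddChar R ℂ} (hψ : ψ.IsPrimitive) (A : Set R) :
    charProjection ψ A * charProjection ψ A = charProjection ψ A := by
  classical
  rw [charProjection, Finset.sum_mul_sum]
  refine Finset.sum_congr rfl fun α hα => ?_
  simp only [charIdempotent_mul hψ]
  rw [Finset.sum_ite_eq, if_pos hα]

theorem charProjection_mul_of_disjoint {ψ : AddChar R ℂ} (hψ : ψ.IsPrimitive) {A B : Set R}
    (h : Disjoint A B) : charProjection ψ A * charProjection ψ B = 0 := by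
  classical
  rw [charProjection, charProjection, Finset.sum_mul_sum]
  refine Finset.sum_eq_zero fun α hα => Finset.sum_eq_zero fun β hβ => ?_
  rw [charIdempotent_mul hψ, if_neg]
  rintro rfl
  exact Set.disjoint_left.mp h (Finset.mem_filter.mp hα).2 (Finset.mem_filter.mp hβ).2

open Classical in
theorem charProjection_apply (ψ : AddChar R ℂ) (A : Set R) (x y : R) :
    charProjection ψ A x y =
      (Fintype.card R : ℂ)⁻¹ * ∑ β : R with β ∈ A, ψ ((y - x) * β) := by
  simp only [charProjection, charIdempotent, Matrix.sum_apply, Matrix.of_apply, Finset.mul_sum]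
  exact Finset.sum_congr rfl fun β _ => by rw [mul_comm β]

theorem charProjection_ne_zero {ψ : AddChar R ℂ} {A : Set R} (hA : A.Nonempty) :
    charProjection ψ A ≠ 0 := by
  classical
  intro h
  have h1 := charProjection_apply ψ A 0 0
  rw [h] at h1
  simp only [Matrix.zero_apply, sub_self, zero_mul, AddChar.map_zero_eq_one, Finset.sum_const,
    nsmul_eq_mul, mul_one] at h1
  obtain ⟨a, ha⟩ := hA
  refine mul_ne_zero (inv_ne_zero card_ne_zero_complex) (Nat.cast_ne_zero.mpr ?_) h1.symm
  exact Finset.card_ne_zero_of_mem (Finset.mem_filter.mpr ⟨Finset.mem_univ a, ha⟩)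

/-- The relation `{(x, y) | x - y ∈ A}`. -/
def diffRel (A : Set R) : Set (R × R) := {q | q.1 - q.2 ∈ A}

open Classical in
/-- Fourier inversion: the spectral decomposition of the adjacency matrix of a translation
relation. -/
theorem relAdjMatrix_diffRel_eq_sum_charIdempotent {ψ : AddChar R ℂ} (hψ : ψ.IsPrimitive)
    (A : Set R) :
    relAdjMatrix (diffRel A) =
      ∑ α : R, (∑ β : R with β ∈ A, ψ (α * β)) • charIdempotent ψ α := by
  ext x y
  have hterm : ∀ α, ((∑ β : R with β ∈ A, ψ (α * β)) • charIdempotent ψ α) x y =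
      ∑ β : R with β ∈ A, (Fintype.card R : ℂ)⁻¹ * ψ (α * (β - (x - y))) := by
    intro α
    rw [Matrix.smul_apply, smul_eq_mul, Finset.sum_mul]
    refine Finset.sum_congr rfl fun β _ => ?_
    have : ψ (α * (β - (x - y))) = ψ (α * β) * ψ (α * (y - x)) := by
      rw [← AddChar.map_add_eq_mul]
      congr 1
      ring
    rw [this, charIdempotent, Matrix.of_apply]
    ring
  rw [Matrix.sum_apply, Finset.sum_congr rfl fun α _ => hterm α, Finset.sum_comm]
  simp only [← Finset.mul_sum, AddChar.sum_mulShift _ hψ, sub_eq_zero, Nat.cast_ite, Nat.cast_zero]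
  rw [Finset.sum_ite_eq', relAdjMatrix, Matrix.of_apply]
  simp only [diffRel, Set.mem_ofPred_eq, Finset.mem_filter, Finset.mem_univ, true_and, mul_ite,
    mul_zero]
  rw [inv_mul_cancel₀ card_ne_zero_complex]
  congr

variable {d : ℕ} {ψ : AddChar R ℂ} {S : Fin (d + 1) → Set R}
  {M : Matrix (Fin (d + 1)) (Fin (d + 1)) ℂ}

open Classical in
/-- If the character sums over the blocks of a partition are constant on these blocks, then the
adjacency matrices are combinations of the projections attached to the blocks. -/
theorem relAdjMatrix_diffRel_eq_sum_charProjection (hψ : ψ.IsPrimitive)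
    (hdisj : ∀ i j a, a ∈ S i → a ∈ S j → i = j) (hcov : ∀ a, ∃ i, a ∈ S i)
    (hsum : ∀ i j, ∀ α ∈ S i, ∑ β : R with β ∈ S j, ψ (α * β) = M i j) (j : Fin (d + 1)) :
    relAdjMatrix (diffRel (S j)) = ∑ i, M i j • charProjection ψ (S i) := by
  choose c hc using hcov
  have hcS : ∀ a i, a ∈ S i ↔ c a = i :=
    fun a i => ⟨fun h => hdisj _ _ a (hc a) h, fun h => h ▸ hc a⟩
  rw [relAdjMatrix_diffRel_eq_sum_charIdempotent hψ,
    ← Finset.sum_fiberwise (s := Finset.univ) (g := c)]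
  refine Finset.sum_congr rfl fun i _ => ?_
  rw [charProjection, Finset.smul_sum]
  refine Finset.sum_congr (by simp only [hcS]) fun α hα => ?_
  rw [hsum i j α (Finset.mem_filter.mp hα).2]

open Classical in
/-- The dual formula: the projections are combinations of the adjacency matrices. The block
numbered `σ j` is the negative of the block numbered `j`. -/
theorem charProjection_eq_sum_relAdjMatrix {σ : Fin (d + 1) → Fin (d + 1)}
    (hdisj : ∀ i j a, a ∈ S i → a ∈ S j → i = j) (hcov : ∀ a, ∃ i, a ∈ S i)
    (hσ : ∀ i a, a ∈ S (σ i) ↔ -a ∈ S i)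
    (hsum : ∀ i j, ∀ α ∈ S i, ∑ β : R with β ∈ S j, ψ (α * β) = M i j) (i : Fin (d + 1)) :
    charProjection ψ (S i) =
      ∑ j, ((Fintype.card R : ℂ)⁻¹ * M j i) • relAdjMatrix (diffRel (S (σ j))) := by
  ext x y
  obtain ⟨k, hk⟩ := hcov (y - x)
  rw [charProjection_apply, hsum k i _ hk, Matrix.sum_apply, Finset.sum_eq_single k]
  · have : x - y ∈ S (σ k) := by rw [hσ, neg_sub]; exact hk
    simp [relAdjMatrix, diffRel, this]
  · intro j _ hj
    have : x - y ∉ S (σ j) := by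
      rw [hσ, neg_sub]
      exact fun h => hj (hdisj _ _ _ h hk)
    simp [relAdjMatrix, diffRel, this]
  · simp

section OrthogonalIdempotents

variable {X : Type*} [Fintype X] {ι : Type*} [Fintype ι] {E : ι → Matrix X X ℂ}

theorem mul_sum_smul_of_orthogonal (hself : ∀ i, E i * E i = E i)
    (horth : ∀ i j, i ≠ j → E i * E j = 0) (c : ι → ℂ) (i : ι) :
    E i * ∑ j, c j • E j = c i • E i := by
  rw [Finset.mul_sum, Finset.sum_eq_single i]
  · rw [Matrix.mul_smul, hself]
  · intro j _ hj
    rw [Matrix.mul_smul, horth i j hj.symm, smul_zero]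
  · simp

theorem sum_smul_mul_of_orthogonal (hself : ∀ i, E i * E i = E i)
    (horth : ∀ i j, i ≠ j → E i * E j = 0) (c : ι → ℂ) (i : ι) :
    (∑ j, c j • E j) * E i = c i • E i := by
  rw [Finset.sum_mul, Finset.sum_eq_single i]
  · rw [Matrix.smul_mul, hself]
  · intro j _ hj
    rw [Matrix.smul_mul, horth j i hj, smul_zero]
  · simp

theorem sum_smul_mul_sum_smul_of_orthogonal (hself : ∀ i, E i * E i = E i)
    (horth : ∀ i j, i ≠ j → E i * E j = 0) (c c' : ι → ℂ) :
    (∑ j, c j • E j) * ∑ j, c' j • E j = ∑ j, (c j * c' j) • E j := by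
  rw [Finset.sum_mul]
  refine Finset.sum_congr rfl fun i _ => ?_
  rw [Matrix.smul_mul, mul_sum_smul_of_orthogonal hself horth, smul_smul]

/-- The primitive idempotents of the span of nonzero orthogonal idempotents are these idempotents
themselves. -/
theorem range_eq_primitiveIdempotents (hself : ∀ i, E i * E i = E i)
    (horth : ∀ i j, i ≠ j → E i * E j = 0) (hne : ∀ i, E i ≠ 0) :
    Set.range E = {F | IsPrimitiveIdempotentOf (Submodule.span ℂ (Set.range E)) F} := by
  have hmem : ∀ i, E i ∈ Submodule.span ℂ (Set.range E) :=
    fun i => Submodule.subset_span ⟨i, rfl⟩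
  -- An idempotent of the span has coefficients `0` and `1`.
  have hcoef : ∀ c : ι → ℂ,
      (∑ j, c j • E j) * (∑ j, c j • E j) = ∑ j, c j • E j → ∀ i, c i = 0 ∨ c i = 1 := by
    intro c hc i
    have h := congrArg (E i * ·) hc
    simp only [sum_smul_mul_sum_smul_of_orthogonal hself horth,
      mul_sum_smul_of_orthogonal hself horth] at h
    have h2 : c i * c i = c i := smul_left_injective ℂ (hne i) h
    by_cases h0 : c i = 0
    · exact Or.inl h0
    · exact Or.inr (mul_left_cancel₀ h0 (by rw [h2, mul_one]))
  ext F
  constructor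
  · rintro ⟨i, rfl⟩
    refine ⟨hmem i, hne i, hself i, fun F hF hFF hEF _ => ?_⟩
    obtain ⟨c, rfl⟩ := (Submodule.mem_span_range_iff_exists_fun ℂ).mp hF
    rw [mul_sum_smul_of_orthogonal hself horth] at hEF
    rw [← hEF]
    rcases hcoef c hFF i with h | h
    · left; rw [h, zero_smul]
    · right; rw [h, one_smul]
  · rintro ⟨hF, hF0, hFF, hprim⟩
    obtain ⟨c, rfl⟩ := (Submodule.mem_span_range_iff_exists_fun ℂ).mp hF
    obtain ⟨i, hi⟩ : ∃ i, c i ≠ 0 := by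
      by_contra! h
      exact hF0 (by simp [h])
    have hi1 := (hcoef c hFF i).resolve_left hi
    refine ⟨i, (hprim (E i) (hmem i) (hself i) ?_ ?_).resolve_left (hne i)⟩
    · rw [sum_smul_mul_of_orthogonal hself horth, hi1, one_smul]
    · rw [mul_sum_smul_of_orthogonal hself horth, hi1, one_smul]

end OrthogonalIdempotents

/-- The span of the adjacency matrices equals the span of the projections. -/
theorem boseMesner_diffRel_eq_span (hψ : ψ.IsPrimitive)
    (hdisj : ∀ i j a, a ∈ S i → a ∈ S j → i = j) (hcov : ∀ a, ∃ i, a ∈ S i)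
    (hneg : ∀ i, ∃ i', ∀ a, a ∈ S i' ↔ -a ∈ S i)
    (hsum : ∀ i j, ∀ α ∈ S i, (open Classical in ∑ β : R with β ∈ S j, ψ (α * β)) = M i j) :
    boseMesner (fun j => diffRel (S j)) =
      Submodule.span ℂ (Set.range fun i => charProjection ψ (S i)) := by
  choose σ hσ using hneg
  refine le_antisymm (Submodule.span_le.mpr ?_) (Submodule.span_le.mpr ?_)
  · rintro _ ⟨j, rfl⟩
    simp only [SetLike.mem_coe]
    rw [relAdjMatrix_diffRel_eq_sum_charProjection hψ hdisj hcov hsum]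
    exact Submodule.sum_mem _ fun i _ =>
      Submodule.smul_mem _ _ (Submodule.subset_span ⟨i, rfl⟩)
  · rintro _ ⟨j, rfl⟩
    simp only [SetLike.mem_coe]
    rw [charProjection_eq_sum_relAdjMatrix hdisj hcov hσ hsum]
    exact Submodule.sum_mem _ fun i _ =>
      Submodule.smul_mem _ _ (Submodule.subset_span ⟨σ i, rfl⟩)

/-- A partition of a finite ring whose character sums are constant on the blocks of the same
partition yields a commutative association scheme: products of adjacency matrices are combinations
of the projections, hence again of adjacency matrices, and such a matrix has constant entries on
each relation. -/
theorem isCommAssociationScheme_diffRel (hψ : ψ.IsPrimitive) (hzero : S 0 = {0})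
    (hne : ∀ i, (S i).Nonempty)
    (hdisj : ∀ i j a, a ∈ S i → a ∈ S j → i = j) (hcov : ∀ a, ∃ i, a ∈ S i)
    (hneg : ∀ i, ∃ i', ∀ a, a ∈ S i' ↔ -a ∈ S i)
    (hsum : ∀ i j, ∀ α ∈ S i, (open Classical in ∑ β : R with β ∈ S j, ψ (α * β)) = M i j) :
    IsCommAssociationScheme d (fun j => diffRel (S j)) := by
  classical
  have hself : ∀ i, charProjection ψ (S i) * charProjection ψ (S i) = charProjection ψ (S i) :=
    fun i => charProjection_mul_self hψ _
  have horth : ∀ i j, i ≠ j → charProjection ψ (S i) * charProjection ψ (S j) = 0 :=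
    fun i j hij => charProjection_mul_of_disjoint hψ
      (Set.disjoint_left.mpr fun a hi hj => hij (hdisj i j a hi hj))
  have hprod : ∀ i j, relAdjMatrix (diffRel (S i)) * relAdjMatrix (diffRel (S j)) =
      ∑ k, (M k i * M k j) • charProjection ψ (S k) := fun i j => by
    rw [relAdjMatrix_diffRel_eq_sum_charProjection hψ hdisj hcov hsum,
      relAdjMatrix_diffRel_eq_sum_charProjection hψ hdisj hcov hsum,
      sum_smul_mul_sum_smul_of_orthogonal hself horth]
  -- Elements of the Bose–Mesner algebra have constant entries on each relation.
  have hconst : ∀ F ∈ boseMesner (fun j => diffRel (S j)), ∀ k x y x' y',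
      x - y ∈ S k → x' - y' ∈ S k → F x y = F x' y' := by
    intro F hF k x y x' y' h h'
    obtain ⟨c, rfl⟩ := (Submodule.mem_span_range_iff_exists_fun ℂ).mp hF
    simp only [Matrix.sum_apply, Matrix.smul_apply]
    refine Finset.sum_congr rfl fun j _ => ?_
    have : x - y ∈ S j ↔ x' - y' ∈ S j :=
      ⟨fun hj => hdisj _ _ _ h hj ▸ h', fun hj => hdisj _ _ _ h' hj ▸ h⟩
    by_cases hj : x' - y' ∈ S j <;> simp [relAdjMatrix, diffRel, this, hj]
  have hmem : ∀ i j, relAdjMatrix (diffRel (S i)) * relAdjMatrix (diffRel (S j)) ∈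
      boseMesner (fun j => diffRel (S j)) := fun i j => by
    rw [boseMesner_diffRel_eq_span hψ hdisj hcov hneg hsum, hprod]
    exact Submodule.sum_mem _ fun k _ =>
      Submodule.smul_mem _ _ (Submodule.subset_span ⟨k, rfl⟩)
  choose s hs using hne
  refine ⟨?_, fun i => ⟨(s i, 0), ?_⟩, fun i j hij => ?_, ?_, fun i => ?_,
    fun i j k => {z : R | (s k, z) ∈ diffRel (S i) ∧ (z, 0) ∈ diffRel (S j)}.ncard, ?_, ?_⟩
  · ext q
    simp [diffRel, hzero, sub_eq_zero]
  · simpa [diffRel] using hs i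
  · exact Set.disjoint_left.mpr fun q hi hj => hij (hdisj i j _ hi hj)
  · ext q
    simpa [diffRel] using hcov (q.1 - q.2)
  · obtain ⟨i', hi'⟩ := hneg i
    refine ⟨i', ?_⟩
    ext q
    simp [diffRel, hi']
  · intro i j k x y hxy
    have h := hconst _ (hmem i j) k x y (s k) 0 hxy (by simpa using hs k)
    rw [relAdjMatrix_mul_apply, relAdjMatrix_mul_apply] at h
    exact_mod_cast h
  · intro i j k
    have h : (relAdjMatrix (diffRel (S i)) * relAdjMatrix (diffRel (S j))) (s k) 0 =
        (relAdjMatrix (diffRel (S j)) * relAdjMatrix (diffRel (S i))) (s k) 0 := by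
      rw [hprod, hprod]
      simp only [mul_comm]
    rw [relAdjMatrix_mul_apply, relAdjMatrix_mul_apply] at h
    exact_mod_cast h

/-- For such a scheme the table of character sums is the first eigenmatrix. -/
theorem isFirstEigenmatrix_diffRel (hψ : ψ.IsPrimitive) (hzero : S 0 = {0})
    (hne : ∀ i, (S i).Nonempty)
    (hdisj : ∀ i j a, a ∈ S i → a ∈ S j → i = j) (hcov : ∀ a, ∃ i, a ∈ S i)
    (hneg : ∀ i, ∃ i', ∀ a, a ∈ S i' ↔ -a ∈ S i)
    (hsum : ∀ i j, ∀ α ∈ S i, (open Classical in ∑ β : R with β ∈ S j, ψ (α * β)) = M i j) :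
    IsFirstEigenmatrix (fun j => diffRel (S j)) M := by
  classical
  have hself : ∀ i, charProjection ψ (S i) * charProjection ψ (S i) = charProjection ψ (S i) :=
    fun i => charProjection_mul_self hψ _
  have horth : ∀ i j, i ≠ j → charProjection ψ (S i) * charProjection ψ (S j) = 0 :=
    fun i j hij => charProjection_mul_of_disjoint hψ
      (Set.disjoint_left.mpr fun a hi hj => hij (hdisj i j a hi hj))
  refine ⟨fun i => charProjection ψ (S i), fun i j hij => ?_, ?_, ?_,
    relAdjMatrix_diffRel_eq_sum_charProjection hψ hdisj hcov hsum⟩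
  · by_contra h
    have h0 := horth i j h
    simp only at hij
    rw [← hij, hself] at h0
    exact charProjection_ne_zero (hne i) h0
  · rw [boseMesner_diffRel_eq_span hψ hdisj hcov hneg hsum]
    exact range_eq_primitiveIdempotents hself horth fun i => charProjection_ne_zero (hne i)
  · ext x y
    simp only
    rw [charProjection_apply, hzero]
    simp [Finset.sum_filter]

end TranslationScheme

namespace GaloisPoly

variable {e : ℕ} (Φ : GaloisPoly e)

/-! ### The residue field -/

noncomputable instance fact_irreducible : Fact (Irreducible (Φ.poly.map redTwo)) :=
  ⟨Φ.primitive.2.1⟩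

theorem e_ne_zero {e : ℕ} (Φ : GaloisPoly e) : e ≠ 0 := by
  rw [← Φ.degree]
  exact Φ.primitive.2.1.natDegree_pos.ne'

theorem finrank_res : Module.finrank (ZMod 2) Φ.Res = e := by
  conv_rhs => rw [← Φ.degree]
  exact finrank_quotient_span_eq_natDegree

instance finite_res : Finite Φ.Res := by
  have := Φ.primitive.1.finite_adjoinRoot
  exact Module.finite_of_finite (ZMod 2)

noncomputable instance fintype_res : Fintype Φ.Res := Fintype.ofFinite _

theorem card_res : Nat.card Φ.Res = 2 ^ e := by
  have := Φ.primitive.1.finite_adjoinRoot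
  rw [Module.natCard_eq_pow_finrank (K := ZMod 2), finrank_res]
  simp

/-- The trace of the residue field over `𝔽₂`. -/
noncomputable def resTrace : Φ.Res →ₗ[ZMod 2] ZMod 2 := Algebra.trace (ZMod 2) Φ.Res

/-- The reduction map from the Galois ring onto its residue field. -/
noncomputable def residue : Φ.Ring →+* Φ.Res :=
  AdjoinRoot.map redTwo Φ.poly (Φ.poly.map redTwo) dvd_rfl

theorem residue_mk (p : (ZMod 4)[X]) :
    Φ.residue (AdjoinRoot.mk Φ.poly p) = AdjoinRoot.mk (Φ.poly.map redTwo) (p.map redTwo) := by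
  rw [residue, AdjoinRoot.map, AdjoinRoot.lift_mk, ← AdjoinRoot.aeval_eq, aeval_def, eval₂_map]
  rfl

theorem residue_ξ : Φ.residue Φ.ξ = Φ.ζ := by
  simp [residue, ξ, ζ]

theorem two_res : (2 : Φ.Res) = 0 := by
  have h : (2 : ZMod 2) = 0 := by decide
  have := congrArg (algebraMap (ZMod 2) Φ.Res) h
  rwa [map_ofNat, map_zero] at this

theorem residue_surjective : Function.Surjective Φ.residue := by
  intro x
  obtain ⟨p, rfl⟩ := AdjoinRoot.mk_surjective x
  obtain ⟨q, rfl⟩ := Polynomial.map_surjective redTwo redTwo_surjective p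
  exact ⟨_, Φ.residue_mk q⟩

theorem residue_eq_zero_iff (x : Φ.Ring) : Φ.residue x = 0 ↔ ∃ y, x = 2 * y := by
  constructor
  · intro h
    obtain ⟨p, rfl⟩ := AdjoinRoot.mk_surjective x
    rw [residue_mk, AdjoinRoot.mk_eq_zero] at h
    obtain ⟨q, hq⟩ := h
    obtain ⟨q, rfl⟩ := Polynomial.map_surjective redTwo redTwo_surjective q
    obtain ⟨r, hr⟩ := map_eq_zero_of (p - Φ.poly * q) (by
      rw [Polynomial.map_sub, Polynomial.map_mul, hq, sub_self])
    refine ⟨AdjoinRoot.mk Φ.poly r, ?_⟩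
    have := congrArg (AdjoinRoot.mk Φ.poly) hr
    simp only [map_sub, map_mul, AdjoinRoot.mk_self, zero_mul, sub_zero, map_ofNat] at this
    exact this
  · rintro ⟨y, rfl⟩
    rw [map_mul, map_ofNat, two_res, zero_mul]

theorem residue_eq_iff (x y : Φ.Ring) : Φ.residue x = Φ.residue y ↔ ∃ z, x = y + 2 * z := by
  rw [← sub_eq_zero, ← map_sub, residue_eq_zero_iff]
  exact exists_congr fun z => sub_eq_iff_eq_add'

theorem two_mul_eq_zero_iff (x : Φ.Ring) : 2 * x = 0 ↔ Φ.residue x = 0 := by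
  rw [residue_eq_zero_iff]
  refine ⟨Φ.eq_two_mul_of_two_mul x, ?_⟩
  rintro ⟨y, rfl⟩
  exact Φ.two_mul_two y

theorem two_mul_eq_iff (x y : Φ.Ring) : 2 * x = 2 * y ↔ Φ.residue x = Φ.residue y := by
  rw [← sub_eq_zero, ← mul_sub, two_mul_eq_zero_iff, map_sub, sub_eq_zero]

/-- The additive bijection `K → 2R` induced by multiplication by two on `R`: twice an arbitrary
lift. -/
noncomputable def dbl (x : Φ.Res) : Φ.Ring := 2 * Function.surjInv Φ.residue_surjective x

theorem dbl_residue (y : Φ.Ring) : Φ.dbl (Φ.residue y) = 2 * y := by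
  rw [dbl, two_mul_eq_iff, Function.surjInv_eq Φ.residue_surjective]

theorem dbl_injective : Function.Injective Φ.dbl := by
  intro x y h
  obtain ⟨x, rfl⟩ := Φ.residue_surjective x
  obtain ⟨y, rfl⟩ := Φ.residue_surjective y
  rw [dbl_residue, dbl_residue] at h
  exact (Φ.two_mul_eq_iff _ _).mp h

theorem dbl_zero : Φ.dbl 0 = 0 := by
  rw [← map_zero Φ.residue, dbl_residue, mul_zero]

theorem dbl_one : Φ.dbl 1 = 2 := by
  rw [← map_one Φ.residue, dbl_residue, mul_one]

theorem dbl_add (x y : Φ.Res) : Φ.dbl (x + y) = Φ.dbl x + Φ.dbl y := by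
  obtain ⟨x, rfl⟩ := Φ.residue_surjective x
  obtain ⟨y, rfl⟩ := Φ.residue_surjective y
  rw [← map_add, dbl_residue, dbl_residue, dbl_residue, mul_add]

theorem neg_dbl (x : Φ.Res) : -Φ.dbl x = Φ.dbl x := by
  obtain ⟨x, rfl⟩ := Φ.residue_surjective x
  rw [dbl_residue]
  linear_combination -Φ.two_mul_two x

theorem residue_dbl (x : Φ.Res) : Φ.residue (Φ.dbl x) = 0 := by
  rw [residue_eq_zero_iff]
  exact ⟨_, rfl⟩

theorem mul_dbl (α : Φ.Ring) (x : Φ.Res) : α * Φ.dbl x = Φ.dbl (Φ.residue α * x) := by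
  obtain ⟨x, rfl⟩ := Φ.residue_surjective x
  rw [← map_mul, dbl_residue, dbl_residue]
  ring

/-- Since `-1 = 1 + 2` modulo four, negation shifts the parameter of a principal unit by `1`. -/
theorem neg_one_add_dbl (x : Φ.Res) : -(1 + Φ.dbl x) = 1 + Φ.dbl (x + 1) := by
  rw [dbl_add, dbl_one]
  linear_combination Φ.neg_dbl x - Φ.two_mul_two 1

/-! ### Teichmüller representatives -/

/-- Squaring forgets multiples of two, so `y ^ 2 ^ e` depends only on the residue of `y`. -/
theorem pow_eq_of_residue_eq {x y : Φ.Ring} (h : Φ.residue x = Φ.residue y) :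
    x ^ 2 ^ e = y ^ 2 ^ e := by
  obtain ⟨z, rfl⟩ := (Φ.residue_eq_iff x y).mp h
  have hk : 2 ^ e = 2 * 2 ^ (e - 1) := (mul_pow_sub_one Φ.e_ne_zero 2).symm
  have h2 : (y + 2 * z) ^ 2 = y ^ 2 := by
    linear_combination Φ.two_mul_two (y * z) + Φ.two_mul_two (z * z)
  rw [hk, pow_mul, pow_mul, h2]

/-- The Teichmüller lift `K → R`: the `2 ^ e`-th power of an arbitrary lift. -/
noncomputable def teich (x : Φ.Res) : Φ.Ring :=
  Function.surjInv Φ.residue_surjective x ^ 2 ^ e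

theorem teich_residue (y : Φ.Ring) : Φ.teich (Φ.residue y) = y ^ 2 ^ e :=
  Φ.pow_eq_of_residue_eq (Function.surjInv_eq Φ.residue_surjective _)

theorem residue_teich (x : Φ.Res) : Φ.residue (Φ.teich x) = x := by
  rw [teich, map_pow, Function.surjInv_eq Φ.residue_surjective, ← Φ.card_res, ← Fintype.card_eq_nat_card]
  exact FiniteField.pow_card x

theorem teich_mul (x y : Φ.Res) : Φ.teich (x * y) = Φ.teich x * Φ.teich y := by
  obtain ⟨x, rfl⟩ := Φ.residue_surjective x
  obtain ⟨y, rfl⟩ := Φ.residue_surjective y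
  rw [← map_mul, teich_residue, teich_residue, teich_residue, mul_pow]

theorem teich_one : Φ.teich 1 = 1 := by
  rw [← map_one Φ.residue, teich_residue, one_pow]

theorem teich_ζ_pow (j : ℕ) : Φ.teich (Φ.ζ ^ j) = Φ.ξ ^ j := by
  rw [← residue_ξ, ← map_pow, teich_residue, ← pow_mul, mul_comm, pow_mul, ξ_pow]

theorem ζ_ne_zero (he : 2 ≤ e) : Φ.ζ ≠ 0 := by
  intro h
  have hord := Φ.primitive.2.2
  rw [Φ.degree, Nat.card_zmod, show AdjoinRoot.root _ = (0 : Φ.Res) from h, orderOf_zero] at hord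
  have h4 : 2 ^ 2 ≤ 2 ^ e := Nat.pow_le_pow_right (by norm_num) he
  omega

/-- Since `ζ` is primitive, every nonzero residue is a power of `ζ`. -/
theorem exists_ζ_pow (he : 2 ≤ e) {x : Φ.Res} (hx : x ≠ 0) : ∃ j ≤ 2 ^ e - 2, x = Φ.ζ ^ j := by
  classical
  have hord : orderOf Φ.ζ = 2 ^ e - 1 := by
    have := Φ.primitive.2.2
    rwa [Φ.degree, Nat.card_zmod] at this
  have h4 : 2 ^ 2 ≤ 2 ^ e := Nat.pow_le_pow_right (by norm_num) he
  let u : Φ.Resˣ := Units.mk0 Φ.ζ (Φ.ζ_ne_zero he)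
  have hu : orderOf u = Nat.card Φ.Resˣ := by
    rw [← orderOf_units, Nat.card_units, Φ.card_res]
    exact hord
  have hmem : Units.mk0 x hx ∈ Subgroup.zpowers u := by
    rw [Subgroup.eq_top_of_card_eq _ ((Nat.card_zpowers u).trans hu)]
    trivial
  rw [← mem_powers_iff_mem_zpowers, mem_powers_iff_mem_range_orderOf, Finset.mem_image] at hmem
  obtain ⟨j, hj, hjx⟩ := hmem
  rw [Finset.mem_range, ← orderOf_units] at hj
  change j < orderOf Φ.ζ at hj
  refine ⟨j, by omega, ?_⟩
  simpa [u] using (congrArg Units.val hjx).symm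

theorem T_eq_image (he : 2 ≤ e) : Φ.T = Φ.teich '' {x | x ≠ 0} := by
  ext α
  constructor
  · rintro ⟨j, -, rfl⟩
    exact ⟨Φ.ζ ^ j, pow_ne_zero _ (Φ.ζ_ne_zero he), Φ.teich_ζ_pow j⟩
  · rintro ⟨x, hx, rfl⟩
    obtain ⟨j, hj, rfl⟩ := Φ.exists_ζ_pow he hx
    exact ⟨j, hj, Φ.teich_ζ_pow j⟩

theorem teich_eq_one_iff (x : Φ.Res) : Φ.teich x = 1 ↔ x = 1 := by
  refine ⟨fun h => ?_, fun h => h ▸ Φ.teich_one⟩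
  rw [← Φ.residue_teich x, h, map_one]

/-! ### The blocks in Teichmüller coordinates -/

theorem P_eq_range : Φ.P = Set.range Φ.dbl := by
  ext α
  constructor
  · rintro ⟨y, rfl⟩
    exact ⟨_, Φ.dbl_residue y⟩
  · rintro ⟨x, rfl⟩
    exact ⟨_, rfl⟩

theorem P₀_eq_image (he : 2 ≤ e) : Φ.P₀ = Φ.dbl '' {x | Φ.resTrace x = 0} := by
  ext α
  constructor
  · rintro (⟨_, ⟨j, -, hj, rfl⟩, rfl⟩ | rfl)
    · exact ⟨Φ.ζ ^ j, hj, by rw [← residue_ξ, ← map_pow, dbl_residue]⟩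
    · exact ⟨0, map_zero _, Φ.dbl_zero⟩
  · rintro ⟨x, hx, rfl⟩
    by_cases h0 : x = 0
    · right
      rw [h0, dbl_zero]
      rfl
    · obtain ⟨j, hj, rfl⟩ := Φ.exists_ζ_pow he h0
      exact Or.inl ⟨Φ.ξ ^ j, ⟨j, hj, hx, rfl⟩, by rw [← residue_ξ, ← map_pow, dbl_residue]⟩

theorem resTrace_one (hodd : Odd e) : Φ.resTrace 1 = 1 := by
  have := Algebra.trace_algebraMap (R := ZMod 2) (S := Φ.Res) 1
  rw [map_one, finrank_res] at this
  rw [resTrace, this]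
  obtain ⟨k, hk⟩ := hodd
  rw [hk, nsmul_one, Nat.cast_add, Nat.cast_mul, Nat.cast_two, show (2 : ZMod 2) = 0 by decide]
  simp

/-- The coset `1 + {2x | Tr x = δ}` of principal units; `H` for `δ = 0` and `-H` for `δ = 1`. -/
def unitCoset (δ : ZMod 2) : Set Φ.Ring :=
  (fun x => 1 + Φ.dbl x) '' {x | Φ.resTrace x = δ}

theorem H_eq (he : 2 ≤ e) : Φ.H = Φ.unitCoset 0 := by
  ext α
  simp only [H, unitCoset, P₀_eq_image Φ he, Set.mem_image, Set.mem_ofPred_eq]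
  constructor
  · rintro ⟨_, ⟨x, hx, rfl⟩, rfl⟩
    exact ⟨x, hx, rfl⟩
  · rintro ⟨x, hx, rfl⟩
    exact ⟨_, ⟨x, hx, rfl⟩, rfl⟩

theorem neg_H_eq (he : 2 ≤ e) (hodd : Odd e) : -Φ.H = Φ.unitCoset 1 := by
  rw [H_eq Φ he]
  ext α
  simp only [unitCoset, Set.mem_neg, Set.mem_image, Set.mem_ofPred_eq]
  have key : ∀ x, Φ.resTrace (x + 1) = Φ.resTrace x + 1 := fun x => by
    rw [map_add, resTrace_one Φ hodd]
  constructor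
  · rintro ⟨x, hx, h⟩
    exact ⟨x + 1, by rw [key, hx, zero_add], by rw [← neg_one_add_dbl, h, neg_neg]⟩
  · rintro ⟨x, hx, rfl⟩
    exact ⟨x + 1, by rw [key, hx]; decide, by rw [← neg_one_add_dbl]⟩

/-! ### The additive character -/

theorem residue_frob (α : Φ.Ring) : Φ.residue (Φ.frob α) = Φ.residue α ^ 2 := by
  obtain ⟨p, rfl⟩ := AdjoinRoot.mk_surjective α
  obtain ⟨y, hy⟩ := Φ.aeval_ξ_sq p
  have : Φ.frob (AdjoinRoot.mk Φ.poly p) = aeval (Φ.ξ ^ 2) p := by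
    rw [← aeval_ξ]
    exact Φ.frobHom_aeval p
  rw [this, hy, aeval_ξ, ← map_pow Φ.residue, residue_eq_iff]
  exact ⟨y, rfl⟩

theorem residue_frob_iterate (k : ℕ) (α : Φ.Ring) :
    Φ.residue (Φ.frob^[k] α) = Φ.residue α ^ 2 ^ k := by
  induction k with
  | zero => simp
  | succ k ih => rw [Function.iterate_succ_apply', residue_frob, ih, ← pow_mul, pow_succ]

theorem residue_algebraMap (a : ZMod 4) :
    Φ.residue (algebraMap (ZMod 4) Φ.Ring a) = algebraMap (ZMod 2) Φ.Res (redTwo a) :=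
  RingHom.congr_fun (Subsingleton.elim (Φ.residue.comp (algebraMap (ZMod 4) Φ.Ring))
    ((algebraMap (ZMod 2) Φ.Res).comp redTwo)) a

theorem algebraMap_injective : Function.Injective (algebraMap (ZMod 4) Φ.Ring) := by
  have key : ∀ a, algebraMap (ZMod 4) Φ.Ring a = 0 → ∃ b, a = 2 * b := fun a h => by
    apply redTwo_eq_zero
    apply (algebraMap (ZMod 2) Φ.Res).injective
    rw [← residue_algebraMap, h, map_zero, map_zero]
  have key2 : ∀ a, 2 * algebraMap (ZMod 4) Φ.Ring a = 0 → ∃ b, a = 2 * b := fun a h => by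
    apply redTwo_eq_zero
    apply (algebraMap (ZMod 2) Φ.Res).injective
    rw [← residue_algebraMap, (Φ.two_mul_eq_zero_iff _).mp h, map_zero]
  rw [injective_iff_map_eq_zero]
  intro a ha
  obtain ⟨b, rfl⟩ := key a ha
  rw [map_mul, map_ofNat] at ha
  obtain ⟨c, rfl⟩ := key2 b ha
  rw [← mul_assoc, show (2 * 2 : ZMod 4) = 0 by decide, zero_mul]

/-- The Frobenius automorphism lifts squaring on `K`, so `𝒮` lifts the trace of `K`. -/
theorem redTwo_trace (α : Φ.Ring) : redTwo (Φ.trace α) = Φ.resTrace (Φ.residue α) := by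
  apply (algebraMap (ZMod 2) Φ.Res).injective
  rw [← residue_algebraMap, algebraMap_trace, map_sum, resTrace]
  simp only [residue_frob_iterate]
  have := FiniteField.algebraMap_trace_eq_sum_pow (ZMod 2) Φ.Res (Φ.residue α)
  rw [this, finrank_res]
  simp

theorem trace_add (α β : Φ.Ring) : Φ.trace (α + β) = Φ.trace α + Φ.trace β := by
  apply Φ.algebraMap_injective
  rw [map_add, algebraMap_trace, algebraMap_trace, algebraMap_trace, ← Finset.sum_add_distrib]
  exact Finset.sum_congr rfl fun k _ => iterate_map_add _ _ _ _

theorem trace_one : Φ.trace 1 = e := by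
  apply Φ.algebraMap_injective
  rw [algebraMap_trace, map_natCast, Finset.sum_congr rfl fun k _ => iterate_map_one Φ.frob k]
  simp

theorem I_pow_add_val (n : ℕ) (a b : ZMod 4) :
    Complex.I ^ (n * (a + b).val) = Complex.I ^ (n * a.val) * Complex.I ^ (n * b.val) := by
  rw [ZMod.val_add, pow_mul', pow_mul', pow_mul', ← mul_pow, ← pow_add, ← Complex.I_pow_eq_pow_mod]

/-- The character `χ` as an additive character. -/
noncomputable def addChar : AddChar Φ.Ring ℂ where
  toFun := Φ.χ
  map_zero_eq_one' := by
    have : Φ.trace 0 = 0 := by simpa using Φ.trace_add 0 0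
    rw [χ, this]
    simp
  map_add_eq_mul' α β := by rw [χ, χ, χ, trace_add, I_pow_add_val]

/-- The sign `(-1) ^ δ` of `δ ∈ 𝔽₂`, as the cast of an integer so that identities between signs can
be decided. -/
noncomputable def sgn (δ : ZMod 2) : ℂ := ((-1 : ℤ) ^ δ.val : ℤ)

theorem sgn_zero : sgn 0 = 1 := by simp [sgn]

theorem sgn_one : sgn 1 = -1 := by simp [sgn, ZMod.val_one]

theorem sgn_add (a b : ZMod 2) : sgn (a + b) = sgn a * sgn b := by
  have h : ∀ a b : ZMod 2, (-1 : ℤ) ^ (a + b).val = (-1) ^ a.val * (-1) ^ b.val := by decide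
  rw [sgn, h, Int.cast_mul]
  rfl

theorem neg_one_pow_val (t : ZMod 4) : (-1 : ℂ) ^ t.val = sgn (redTwo t) := by
  have h : ∀ t : ZMod 4, (-1 : ℤ) ^ t.val = (-1) ^ (redTwo t).val := by decide
  rw [sgn, ← h]
  push_cast
  rfl

theorem χ_dbl (hodd : Odd e) (x : Φ.Res) : Φ.χ (Φ.dbl x) = sgn (Φ.resTrace x) := by
  obtain ⟨y, rfl⟩ := Φ.residue_surjective x
  rw [dbl_residue, two_mul, χ, trace_add, I_pow_add_val, ← redTwo_trace, ← neg_one_pow_val,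
    ← mul_pow, Complex.I_mul_I, pow_mul, hodd.neg_one_pow]

/-- `χ 1 = i ^ (e ^ 2)`, and the square of an odd number is `1` modulo four. -/
theorem χ_one (hodd : Odd e) : Φ.χ 1 = Complex.I := by
  have h : e % 4 = 1 ∨ e % 4 = 3 := by
    obtain ⟨k, rfl⟩ := hodd
    omega
  rw [χ, trace_one, ZMod.val_natCast, Complex.I_pow_eq_pow_mod, Nat.mul_mod]
  rcases h with h | h <;> simp [h]

/-- Every nonzero ideal of the Galois ring contains `2 R`, hence the element `2`, where `χ` takes the
value `-1`. -/
theorem addChar_isPrimitive (hodd : Odd e) : Φ.addChar.IsPrimitive := by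
  intro a ha h
  have hone : Φ.χ (Φ.dbl 1) ≠ 1 := by
    rw [χ_dbl Φ hodd, resTrace_one Φ hodd, sgn_one]
    norm_num
  have h' : ∀ z, Φ.χ (a * z) = 1 := fun z => DFunLike.congr_fun h z
  by_cases ha0 : Φ.residue a = 0
  · obtain ⟨y, rfl⟩ := (Φ.residue_eq_zero_iff a).mp ha0
    have hy : Φ.residue y ≠ 0 := fun h0 => ha ((Φ.two_mul_eq_zero_iff y).mpr h0)
    obtain ⟨z, hz⟩ := Φ.residue_surjective (Φ.residue y)⁻¹
    apply hone
    rw [← h' z, ← dbl_residue, mul_comm, mul_dbl, hz, inv_mul_cancel₀ hy]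
  · apply hone
    rw [← h' (Φ.dbl (Φ.residue a)⁻¹), mul_dbl, mul_inv_cancel₀ ha0]

/-! ### Character sums over the blocks -/

/-- The additive character `x ↦ (-1) ^ Tr x` of the residue field. -/
noncomputable def resChar : AddChar Φ.Res ℂ where
  toFun x := sgn (Φ.resTrace x)
  map_zero_eq_one' := by rw [map_zero, sgn_zero]
  map_add_eq_mul' x y := by rw [map_add, sgn_add]

theorem resChar_apply (x : Φ.Res) : Φ.resChar x = sgn (Φ.resTrace x) := rfl

open Classical in
theorem sum_sgn_resTrace (hodd : Odd e) (a : Φ.Res) :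
    ∑ x, sgn (Φ.resTrace (a * x)) = if a = 0 then (2 : ℂ) ^ e else 0 := by
  have hne : Φ.resChar ≠ 1 := fun h => by
    have h1 := DFunLike.congr_fun h 1
    rw [resChar_apply, resTrace_one Φ hodd, sgn_one, AddChar.one_apply] at h1
    norm_num at h1
  have h := AddChar.sum_mulShift a (AddChar.IsPrimitive.of_ne_one hne)
  simp only [resChar_apply, mul_comm _ a] at h
  rw [h, Fintype.card_eq_nat_card, card_res]
  push_cast
  rfl

open Classical in
/-- The sum of `(-1) ^ Tr (a x)` over `Tr x = δ`: the indicator of `Tr x = δ` is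
`(1 + (-1) ^ δ (-1) ^ Tr x) / 2`, so only `a = 0` and `a = 1` contribute. -/
theorem sum_sgn_resTrace_fiber (hodd : Odd e) (δ : ZMod 2) (a : Φ.Res) :
    ∑ x with Φ.resTrace x = δ, sgn (Φ.resTrace (a * x)) =
      (if a = 0 then (2 : ℂ) ^ (e - 1) else 0) + sgn δ * if a = 1 then (2 : ℂ) ^ (e - 1) else 0 := by
  have hb : (2 : ℂ) ^ e = 2 * 2 ^ (e - 1) := (mul_pow_sub_one Φ.e_ne_zero 2).symm
  have hind : ∀ t : ZMod 2, (if t = δ then (1 : ℂ) else 0) = (1 + sgn δ * sgn t) / 2 := by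
    -- Over `ℤ` the identity is decidable.
    have hz : ∀ δ t : ZMod 2, (2 * if t = δ then 1 else 0 : ℤ) =
        1 + (-1) ^ δ.val * (-1) ^ t.val := by decide
    intro t
    have := congrArg (Int.cast : ℤ → ℂ) (hz δ t)
    rw [sgn, sgn, eq_div_iff two_ne_zero, mul_comm]
    exact_mod_cast this
  have hterm : ∀ x, (if Φ.resTrace x = δ then sgn (Φ.resTrace (a * x)) else 0) =
      2⁻¹ * sgn (Φ.resTrace (a * x)) + 2⁻¹ * sgn δ * sgn (Φ.resTrace ((a + 1) * x)) := by
    intro x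
    rw [add_mul, one_mul, map_add, sgn_add, ← mul_boole, mul_comm, hind]
    ring
  have ha : a + 1 = 0 ↔ a = 1 := by
    rw [← sub_eq_zero (a := a) (b := 1), show a - 1 = a + 1 by linear_combination -Φ.two_res]
  rw [Finset.sum_filter, Finset.sum_congr rfl fun x _ => hterm x, Finset.sum_add_distrib,
    ← Finset.mul_sum, ← Finset.mul_sum, sum_sgn_resTrace Φ hodd, sum_sgn_resTrace Φ hodd, hb]
  simp only [ha]
  split_ifs <;> ring

theorem charSum_image {ι : Type*} (g : ι → Φ.Ring) (s : Finset ι) (hg : Set.InjOn g s)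
    (α : Φ.Ring) : Φ.charSum α (g '' s) = ∑ x ∈ s, Φ.χ (α * g x) := by
  classical
  rw [charSum, ← Finset.sum_image (f := fun β => Φ.χ (α * β)) hg]
  refine Finset.sum_congr ?_ fun _ _ => rfl
  ext β
  simp

theorem χ_add (α β : Φ.Ring) : Φ.χ (α + β) = Φ.χ α * Φ.χ β :=
  Φ.addChar.map_add_eq_mul α β

/-- The sum of `(-1) ^ Tr (a x)` over `Tr x = δ`. -/
noncomputable def fiberSum (δ : ZMod 2) (a : Φ.Res) : ℂ :=
  ∑ x with Φ.resTrace x = δ, sgn (Φ.resTrace (a * x))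

theorem fiberSum_zero (hodd : Odd e) (δ : ZMod 2) : Φ.fiberSum δ 0 = 2 ^ (e - 1) := by
  classical
  rw [fiberSum, sum_sgn_resTrace_fiber Φ hodd, if_pos rfl, if_neg zero_ne_one]
  ring

theorem fiberSum_one (hodd : Odd e) (δ : ZMod 2) : Φ.fiberSum δ 1 = sgn δ * 2 ^ (e - 1) := by
  classical
  rw [fiberSum, sum_sgn_resTrace_fiber Φ hodd, if_pos rfl, if_neg one_ne_zero]
  ring

theorem fiberSum_eq_zero (hodd : Odd e) (δ : ZMod 2) {a : Φ.Res} (h0 : a ≠ 0) (h1 : a ≠ 1) :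
    Φ.fiberSum δ a = 0 := by
  classical
  rw [fiberSum, sum_sgn_resTrace_fiber Φ hodd, if_neg h0, if_neg h1]
  ring

theorem χ_mul_dbl (hodd : Odd e) (α : Φ.Ring) (x : Φ.Res) :
    Φ.χ (α * Φ.dbl x) = sgn (Φ.resTrace (Φ.residue α * x)) := by
  rw [mul_dbl, χ_dbl Φ hodd]

theorem χ_mul_one_add_dbl (hodd : Odd e) (α : Φ.Ring) (x : Φ.Res) :
    Φ.χ (α * (1 + Φ.dbl x)) = Φ.χ α * sgn (Φ.resTrace (Φ.residue α * x)) := by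
  rw [mul_add, mul_one, χ_add, χ_mul_dbl Φ hodd]

/-- The set of units `teich k * (1 + 2 x)` with `k ≠ 1` and `Tr x = δ`. -/
def unitBlock (δ : ZMod 2) : Set Φ.Ring :=
  (fun p : Φ.Res × Φ.Res => Φ.teich p.1 * (1 + Φ.dbl p.2)) ''
    {p | (p.1 ≠ 0 ∧ p.1 ≠ 1) ∧ Φ.resTrace p.2 = δ}

theorem unitBlock_eq (he : 2 ≤ e) (δ : ZMod 2) :
    Φ.unitBlock δ = (Φ.T \ {1}) * Φ.unitCoset δ := by
  rw [T_eq_image Φ he]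
  ext α
  simp only [unitBlock, unitCoset, Set.mem_mul, Set.mem_sdiff, Set.mem_image, Set.mem_ofPred_eq,
    Set.mem_singleton_iff]
  constructor
  · rintro ⟨⟨k, x⟩, ⟨⟨h0, h1⟩, hx⟩, rfl⟩
    exact ⟨_, ⟨⟨k, h0, rfl⟩, fun h => h1 ((Φ.teich_eq_one_iff k).mp h)⟩, _, ⟨x, hx, rfl⟩, rfl⟩
  · rintro ⟨_, ⟨⟨k, h0, rfl⟩, h1⟩, _, ⟨x, hx, rfl⟩, rfl⟩
    exact ⟨(k, x), ⟨⟨h0, fun h => h1 ((Φ.teich_eq_one_iff k).mpr h)⟩, hx⟩, rfl⟩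

theorem residue_teich_mul (k x : Φ.Res) : Φ.residue (Φ.teich k * (1 + Φ.dbl x)) = k := by
  rw [map_mul, map_add, map_one, residue_teich, residue_dbl, add_zero, mul_one]

/-- The Teichmüller coordinates of a unit are unique. -/
theorem teich_mul_injOn :
    Set.InjOn (fun p : Φ.Res × Φ.Res => Φ.teich p.1 * (1 + Φ.dbl p.2)) {p | p.1 ≠ 0} := by
  rintro ⟨k, x⟩ hk ⟨l, y⟩ - h
  have hkl : k = l := by
    rw [← Φ.residue_teich_mul k x, ← Φ.residue_teich_mul l y]
    exact congrArg Φ.residue h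
  subst hkl
  have hinv : Φ.teich k⁻¹ * Φ.teich k = 1 := by
    rw [← teich_mul, inv_mul_cancel₀ hk, teich_one]
  simp only at h
  have : Φ.dbl x = Φ.dbl y := by
    linear_combination Φ.teich k⁻¹ * h - (Φ.dbl x - Φ.dbl y) * hinv
  rw [Φ.dbl_injective this]

open Classical in
theorem charSum_unitBlock (hodd : Odd e) (δ : ZMod 2) (α : Φ.Ring) :
    Φ.charSum α (Φ.unitBlock δ) = ∑ k : Φ.Res with k ≠ 0 ∧ k ≠ 1,
      Φ.χ (α * Φ.teich k) * Φ.fiberSum δ (Φ.residue α * k) := by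
  have h : Φ.unitBlock δ = (fun p : Φ.Res × Φ.Res => Φ.teich p.1 * (1 + Φ.dbl p.2)) ''
      ((Finset.univ.filter fun k : Φ.Res => k ≠ 0 ∧ k ≠ 1) ×ˢ
        (Finset.univ.filter fun x : Φ.Res => Φ.resTrace x = δ) : Finset _) := by
    rw [unitBlock]
    congr 1
    ext p
    simp
  rw [h, charSum_image, Finset.sum_product]
  · refine Finset.sum_congr rfl fun k _ => ?_
    rw [fiberSum, Finset.mul_sum]
    refine Finset.sum_congr (by congr) fun x _ => ?_
    rw [← mul_assoc, χ_mul_one_add_dbl Φ hodd, map_mul Φ.residue, residue_teich]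
  · refine Φ.teich_mul_injOn.mono fun p hp => ?_
    simp only [Finset.coe_product, Set.mem_prod, Finset.coe_filter, Finset.mem_univ, true_and,
      Set.mem_ofPred_eq] at hp
    exact hp.1.1

theorem charSum_unitCoset (hodd : Odd e) (δ : ZMod 2) (α : Φ.Ring) :
    Φ.charSum α (Φ.unitCoset δ) = Φ.χ α * Φ.fiberSum δ (Φ.residue α) := by
  have h : Φ.unitCoset δ = (fun x => 1 + Φ.dbl x) ''
      (Finset.univ.filter fun x : Φ.Res => Φ.resTrace x = δ : Finset _) := by
    simp [unitCoset]
  rw [h, charSum_image, fiberSum, Finset.mul_sum]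
  · exact Finset.sum_congr rfl fun x _ => χ_mul_one_add_dbl Φ hodd α x
  · exact fun x _ y _ hxy => Φ.dbl_injective (add_left_cancel hxy)

theorem charSum_dbl_fiber (hodd : Odd e) (δ : ZMod 2) (α : Φ.Ring) :
    Φ.charSum α (Φ.dbl '' {x | Φ.resTrace x = δ}) = Φ.fiberSum δ (Φ.residue α) := by
  have h : Φ.dbl '' {x | Φ.resTrace x = δ} = Φ.dbl ''
      (Finset.univ.filter fun x : Φ.Res => Φ.resTrace x = δ : Finset _) := by
    simp
  rw [h, charSum_image _ _ _ Φ.dbl_injective.injOn, fiberSum]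
  exact Finset.sum_congr rfl fun x _ => χ_mul_dbl Φ hodd α x

theorem charSum_dbl_fiber_sdiff_zero (hodd : Odd e) (α : Φ.Ring) :
    Φ.charSum α (Φ.dbl '' {x | Φ.resTrace x = 0} \ {0}) = Φ.fiberSum 0 (Φ.residue α) - 1 := by
  classical
  rw [← charSum_dbl_fiber Φ hodd, charSum, charSum]
  have h0 : Φ.χ (α * 0) = 1 := by
    rw [mul_zero]
    exact Φ.addChar.map_zero_eq_one
  have hmem : (0 : Φ.Ring) ∈ Finset.univ.filter (· ∈ Φ.dbl '' {x | Φ.resTrace x = 0}) :=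
    Finset.mem_filter.mpr ⟨Finset.mem_univ _, 0, map_zero _, Φ.dbl_zero⟩
  rw [← h0, ← Finset.sum_erase_eq_sub (f := fun β => Φ.χ (α * β)) (by convert hmem)]
  refine Finset.sum_congr ?_ fun _ _ => rfl
  ext β
  simp [and_comm]

theorem charSum_singleton_zero (α : Φ.Ring) : Φ.charSum α {0} = 1 := by
  classical
  have h0 : Φ.χ 0 = 1 := Φ.addChar.map_zero_eq_one
  simp [charSum, Finset.sum_filter, h0]

theorem P_sdiff_P₀ (he : 2 ≤ e) : Φ.P \ Φ.P₀ = Φ.dbl '' {x | Φ.resTrace x = 1} := by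
  rw [P_eq_range, P₀_eq_image Φ he, Set.range_sdiff_image Φ.dbl_injective]
  congr 1
  ext x
  have h : ∀ t : ZMod 2, t ≠ 0 ↔ t = 1 := by decide
  exact h _

/-- The blocks in Teichmüller coordinates. -/
theorem S_eq (he : 2 ≤ e) (hodd : Odd e) :
    Φ.S = ![{0}, Φ.unitBlock 0, Φ.unitBlock 1, Φ.unitCoset 0, Φ.unitCoset 1,
      Φ.dbl '' {x | Φ.resTrace x = 0} \ {0}, Φ.dbl '' {x | Φ.resTrace x = 1}] := by
  rw [S, neg_H_eq Φ he hodd, H_eq Φ he, P_sdiff_P₀ Φ he, P₀_eq_image Φ he, unitBlock_eq Φ he,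
    unitBlock_eq Φ he]

theorem charSum_S (he : 2 ≤ e) (hodd : Odd e) (α : Φ.Ring) (j : Fin 7) :
    Φ.charSum α (Φ.S j) =
      ![1, Φ.charSum α (Φ.unitBlock 0), Φ.charSum α (Φ.unitBlock 1),
        Φ.χ α * Φ.fiberSum 0 (Φ.residue α), Φ.χ α * Φ.fiberSum 1 (Φ.residue α),
        Φ.fiberSum 0 (Φ.residue α) - 1, Φ.fiberSum 1 (Φ.residue α)] j := by
  rw [S_eq Φ he hodd]
  fin_cases j
  · exact Φ.charSum_singleton_zero α
  · rfl
  · rfl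
  · exact charSum_unitCoset Φ hodd 0 α
  · exact charSum_unitCoset Φ hodd 1 α
  · exact charSum_dbl_fiber_sdiff_zero Φ hodd α
  · exact charSum_dbl_fiber Φ hodd 1 α

open Classical in
/-- On the maximal ideal the sum over a block of units is a full sum over `K` with the terms at
`0` and `1` removed. -/
theorem charSum_dbl_unitBlock (hodd : Odd e) (δ : ZMod 2) (x : Φ.Res) :
    Φ.charSum (Φ.dbl x) (Φ.unitBlock δ) =
      ((if x = 0 then (2 : ℂ) ^ e else 0) - 1 - sgn (Φ.resTrace x)) * 2 ^ (e - 1) := by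
  have hterm : ∀ k, Φ.χ (Φ.dbl x * Φ.teich k) * Φ.fiberSum δ (Φ.residue (Φ.dbl x) * k) =
      sgn (Φ.resTrace (x * k)) * 2 ^ (e - 1) := by
    intro k
    rw [residue_dbl, zero_mul, fiberSum_zero Φ hodd, mul_comm (Φ.dbl x), χ_mul_dbl Φ hodd,
      residue_teich, mul_comm k]
  rw [charSum_unitBlock Φ hodd, Finset.sum_congr rfl fun k _ => hterm k, ← Finset.sum_mul,
    ← sum_sgn_resTrace Φ hodd x]
  congr 1
  have hfilter : (Finset.univ.filter fun k : Φ.Res => k ≠ 0 ∧ k ≠ 1) =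
      (Finset.univ.erase 0).erase 1 := by
    ext k
    simp [and_comm]
  rw [hfilter, Finset.sum_erase_eq_sub (by simp), Finset.sum_erase_eq_sub (by simp)]
  simp [sgn_zero]

/-- On the principal units no term survives, since `residue α * k = k` avoids `0` and `1`. -/
theorem charSum_unitBlock_of_residue_eq_one (hodd : Odd e) (δ : ZMod 2) {α : Φ.Ring}
    (hα : Φ.residue α = 1) : Φ.charSum α (Φ.unitBlock δ) = 0 := by
  classical
  rw [charSum_unitBlock Φ hodd]
  refine Finset.sum_eq_zero fun k hk => ?_
  obtain ⟨h0, h1⟩ := (Finset.mem_filter.mp hk).2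
  rw [hα, one_mul, fiberSum_eq_zero Φ hodd δ h0 h1, mul_zero]

theorem χ_one_add_dbl (hodd : Odd e) (x : Φ.Res) :
    Φ.χ (1 + Φ.dbl x) = Complex.I * sgn (Φ.resTrace x) := by
  rw [χ_add, χ_one Φ hodd, χ_dbl Φ hodd]

/-- For a unit with residue `k ≠ 1` only the term at `k⁻¹` survives. -/
theorem charSum_teich_mul_unitBlock (hodd : Odd e) (δ : ZMod 2) {k : Φ.Res} (h0 : k ≠ 0)
    (h1 : k ≠ 1) (x : Φ.Res) :
    Φ.charSum (Φ.teich k * (1 + Φ.dbl x)) (Φ.unitBlock δ) =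
      Complex.I * sgn (Φ.resTrace x) * (sgn δ * 2 ^ (e - 1)) := by
  classical
  rw [charSum_unitBlock Φ hodd, residue_teich_mul, Finset.sum_eq_single k⁻¹]
  · rw [mul_inv_cancel₀ h0, fiberSum_one Φ hodd, mul_right_comm, ← teich_mul, mul_inv_cancel₀ h0,
      teich_one, one_mul, χ_one_add_dbl Φ hodd]
  · intro l hl hlk
    rw [fiberSum_eq_zero Φ hodd, mul_zero]
    · exact mul_ne_zero h0 (Finset.mem_filter.mp hl).2.1
    · exact fun h => hlk (eq_inv_of_mul_eq_one_right h)
  · intro h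
    exact absurd (Finset.mem_filter.mpr ⟨Finset.mem_univ _, inv_ne_zero h0, inv_ne_one.mpr h1⟩) h

/-- The character sums are the entries of the eigenmatrix. -/
theorem charSum_eq_eigenmatrixSix (he : 2 ≤ e) (hodd : Odd e) (i j : Fin 7) (α : Φ.Ring)
    (hα : α ∈ Φ.S i) : Φ.charSum α (Φ.S j) = eigenmatrixSix ((2 : ℂ) ^ (e - 1)) i j := by
  have hb : (2 : ℂ) ^ e = 2 * 2 ^ (e - 1) := (mul_pow_sub_one Φ.e_ne_zero 2).symm
  -- The sums at an element of the maximal ideal, a principal unit and any other unit.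
  have hrow : ∀ (x : Φ.Res), ∀ j, Φ.charSum (Φ.dbl x) (Φ.S j) = _ :=
    fun x j => charSum_S Φ he hodd _ j
  simp only [charSum_dbl_unitBlock Φ hodd, residue_dbl, χ_dbl Φ hodd,
    fiberSum_zero Φ hodd, hb] at hrow
  have hcoset : ∀ x δ, Φ.resTrace x = δ → ∀ j,
      Φ.charSum (1 + Φ.dbl x) (Φ.S j) = ![1, 0, 0, Complex.I * sgn δ * 2 ^ (e - 1),
        Complex.I * sgn δ * -2 ^ (e - 1), 2 ^ (e - 1) - 1, -2 ^ (e - 1)] j := by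
    intro x δ hx j
    have hres : Φ.residue (1 + Φ.dbl x) = 1 := by rw [map_add, map_one, residue_dbl, add_zero]
    rw [charSum_S Φ he hodd, charSum_unitBlock_of_residue_eq_one Φ hodd _ hres,
      charSum_unitBlock_of_residue_eq_one Φ hodd _ hres, hres, fiberSum_one Φ hodd,
      fiberSum_one Φ hodd, χ_one_add_dbl Φ hodd, hx, sgn_zero, sgn_one, one_mul, neg_one_mul]
  have hblock : ∀ k x δ, k ≠ 0 → k ≠ 1 → Φ.resTrace x = δ → ∀ j,
      Φ.charSum (Φ.teich k * (1 + Φ.dbl x)) (Φ.S j) = ![1, Complex.I * sgn δ * 2 ^ (e - 1),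
        Complex.I * sgn δ * -2 ^ (e - 1), 0, 0, -1, 0] j := by
    intro k x δ h0 h1 hx j
    rw [charSum_S Φ he hodd, charSum_teich_mul_unitBlock Φ hodd _ h0 h1,
      charSum_teich_mul_unitBlock Φ hodd _ h0 h1, residue_teich_mul,
      fiberSum_eq_zero Φ hodd _ h0 h1, fiberSum_eq_zero Φ hodd _ h0 h1, hx, sgn_zero, sgn_one,
      one_mul, neg_one_mul, mul_zero, zero_sub]
  rw [show Φ.S i = _ from congrFun (S_eq Φ he hodd) i] at hα
  fin_cases i
  · obtain rfl : α = 0 := hα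
    rw [← dbl_zero, hrow]
    fin_cases j <;> simp [eigenmatrixSix, sgn_zero] <;> ring
  · obtain ⟨⟨k, x⟩, ⟨⟨h0, h1⟩, hx⟩, rfl⟩ := hα
    rw [hblock k x 0 h0 h1 hx]
    fin_cases j <;> simp [eigenmatrixSix, sgn_zero, mul_comm]
  · obtain ⟨⟨k, x⟩, ⟨⟨h0, h1⟩, hx⟩, rfl⟩ := hα
    rw [hblock k x 1 h0 h1 hx]
    fin_cases j <;> simp [eigenmatrixSix, sgn_one, mul_comm]
  · obtain ⟨x, hx, rfl⟩ := hα
    rw [hcoset x 0 hx]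
    fin_cases j <;> simp [eigenmatrixSix, sgn_zero, mul_comm]
  · obtain ⟨x, hx, rfl⟩ := hα
    rw [hcoset x 1 hx]
    fin_cases j <;> simp [eigenmatrixSix, sgn_one, mul_comm]
  · obtain ⟨⟨x, hx, rfl⟩, hne⟩ := hα
    have hx0 : x ≠ 0 := fun h => hne (by rw [h, dbl_zero]; rfl)
    rw [Set.mem_ofPred_eq] at hx
    rw [hrow]
    fin_cases j <;> simp [eigenmatrixSix, hx, hx0, sgn_zero] <;> ring
  · obtain ⟨x, hx, rfl⟩ := hα
    rw [Set.mem_ofPred_eq] at hx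
    have hx0 : x ≠ 0 := by
      rintro rfl
      rw [map_zero] at hx
      exact zero_ne_one hx
    rw [hrow]
    fin_cases j <;> simp [eigenmatrixSix, hx, hx0, sgn_one]

/-! ### The blocks form a partition -/

/-- Every element is `dbl x` or `teich k * (1 + dbl x)`; its block is read off from `k` and `Tr x`. -/
theorem mem_S_cover (he : 2 ≤ e) (hodd : Odd e) (α : Φ.Ring) : ∃ i, α ∈ Φ.S i := by
  have hz : ∀ t : ZMod 2, t = 0 ∨ t = 1 := by decide
  rw [S_eq Φ he hodd]
  by_cases hα : Φ.residue α = 0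
  · obtain ⟨y, rfl⟩ := (Φ.residue_eq_zero_iff α).mp hα
    rw [← dbl_residue]
    generalize Φ.residue y = x
    by_cases hx : x = 0
    · exact ⟨0, by rw [hx, dbl_zero]; rfl⟩
    · rcases hz (Φ.resTrace x) with h | h
      · refine ⟨5, ⟨x, h, rfl⟩, fun h0 => hx (Φ.dbl_injective ?_)⟩
        rw [dbl_zero]
        exact h0
      · exact ⟨6, x, h, rfl⟩
  · obtain ⟨z, hα'⟩ := (Φ.residue_eq_iff α (Φ.teich (Φ.residue α))).mp (Φ.residue_teich _).symm
    generalize hk : Φ.residue α = k at hα hα'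
    have hα2 : α = Φ.teich k * (1 + Φ.dbl (k⁻¹ * Φ.residue z)) := by
      rw [hα', mul_add, mul_one, mul_dbl, residue_teich, mul_inv_cancel_left₀ hα, dbl_residue]
    generalize k⁻¹ * Φ.residue z = x at hα2
    by_cases h1 : k = 1
    · rw [h1, teich_one, one_mul] at hα2
      rcases hz (Φ.resTrace x) with h | h
      · exact ⟨3, x, h, hα2.symm⟩
      · exact ⟨4, x, h, hα2.symm⟩
    · rcases hz (Φ.resTrace x) with h | h
      · exact ⟨1, (k, x), ⟨⟨hα, h1⟩, h⟩, hα2.symm⟩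
      · exact ⟨2, (k, x), ⟨⟨hα, h1⟩, h⟩, hα2.symm⟩

theorem neg_dbl_image (A : Set Φ.Res) : -(Φ.dbl '' A) = Φ.dbl '' A := by
  ext α
  rw [Set.mem_neg]
  constructor
  · rintro ⟨x, hx, h⟩
    exact ⟨x, hx, by rw [← neg_dbl, h, neg_neg]⟩
  · rintro ⟨x, hx, rfl⟩
    exact ⟨x, hx, (Φ.neg_dbl x).symm⟩

theorem neg_S (he : 2 ≤ e) (i : Fin 7) : ∃ i', Φ.S i' = -Φ.S i := by
  have hP : -Φ.P = Φ.P := by rw [P_eq_range, ← Set.image_univ, neg_dbl_image]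
  have hP₀ : -Φ.P₀ = Φ.P₀ := by rw [P₀_eq_image Φ he, neg_dbl_image]
  have hsdiff : ∀ A B : Set Φ.Ring, -(A \ B) = -A \ -B := fun _ _ => rfl
  fin_cases i
  · exact ⟨0, by simp [S]⟩
  · exact ⟨2, by simp [S]⟩
  · exact ⟨1, by simp [S]⟩
  · exact ⟨4, by simp [S]⟩
  · exact ⟨3, by simp [S]⟩
  · exact ⟨5, by simp [S, hsdiff, hP₀]⟩
  · exact ⟨6, by simp [S, hsdiff, hP₀, hP]⟩

end GaloisPoly

/-! ### The association scheme -/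

/-- The columns numbered `1` and `3` already separate the rows. -/
theorem eigenmatrixSix_row_injective {b : ℝ} (hb : 1 < b) :
    Function.Injective (eigenmatrixSix (b : ℂ)) := by
  intro i j h
  have h1 := congrFun h 1
  have h3 := congrFun h 3
  have hb0 : b ≠ 0 := by positivity
  have hb1 : b - 1 ≠ 0 := by linarith
  fin_cases i <;> fin_cases j <;> first
    | rfl
    | exfalso
      simp [eigenmatrixSix, Complex.ext_iff, hb0, hb1] at h1 h3 <;> nlinarith

theorem eigenmatrixSix_zero_ne_zero {b : ℂ} (hb : b ≠ 0) (hb1 : b ≠ 1) (j : Fin 7) :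
    eigenmatrixSix b 0 j ≠ 0 := by
  have := sub_ne_zero.mpr hb1
  fin_cases j <;> simp [eigenmatrixSix, hb, this]

theorem mainTheorem2 (e : ℕ) (he : 3 ≤ e) (hodd : Odd e) (Φ : GaloisPoly e) :
    (∀ i j : Fin 7, ∀ α ∈ Φ.S i,
      Φ.charSum α (Φ.S j) = eigenmatrixSix ((2 : ℂ) ^ (e - 1)) i j) ∧
    IsCommAssociationScheme 6 Φ.rel ∧
    ¬ IsSymmetricScheme (d := 6) Φ.rel ∧
    IsFirstEigenmatrix (d := 6) Φ.rel (eigenmatrixSix ((2 : ℂ) ^ (e - 1))) := by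
  have he2 : 2 ≤ e := by omega
  have hb : (2 : ℂ) ^ (e - 1) ≠ 0 := pow_ne_zero _ two_ne_zero
  have hb1 : (2 : ℂ) ^ (e - 1) ≠ 1 := by
    have : 2 ^ (e - 1) ≠ 1 := (Nat.one_lt_two_pow (by omega)).ne'
    exact_mod_cast this
  have hreal : (1 : ℝ) < 2 ^ (e - 1) := one_lt_pow₀ one_lt_two (by omega)
  have hrow : Function.Injective (eigenmatrixSix ((2 : ℂ) ^ (e - 1))) := by
    simpa using eigenmatrixSix_row_injective hreal
  have hsum := Φ.charSum_eq_eigenmatrixSix he2 hodd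
  have hψ := Φ.addChar_isPrimitive hodd
  have hcov := Φ.mem_S_cover he2 hodd
  have hneg : ∀ i, ∃ i', ∀ a, a ∈ Φ.S i' ↔ -a ∈ Φ.S i := fun i => by
    obtain ⟨i', hi'⟩ := Φ.neg_S he2 i
    exact ⟨i', fun a => by rw [hi', Set.mem_neg]⟩
  -- An element of two blocks would give two equal rows of the eigenmatrix.
  have hdisj : ∀ i j a, a ∈ Φ.S i → a ∈ Φ.S j → i = j := fun i j a hi hj =>
    hrow (funext fun k => (hsum i k a hi).symm.trans (hsum j k a hj))
  -- The sizes of the blocks are the entries of the first row of the eigenmatrix.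
  have hne : ∀ i, (Φ.S i).Nonempty := fun i => by
    rw [Set.nonempty_iff_ne_empty]
    intro h
    have h0 := hsum 0 i 0 rfl
    rw [h] at h0
    apply eigenmatrixSix_zero_ne_zero hb hb1 i
    rw [← h0]
    simp [GaloisPoly.charSum]
  refine ⟨hsum, isCommAssociationScheme_diffRel hψ rfl hne hdisj hcov hneg hsum, fun hsymm => ?_,
    isFirstEigenmatrix_diffRel hψ rfl hne hdisj hcov hneg hsum⟩
  -- The pair `(h, 0)` with `h ∈ H` lies in the relation of `H`, its transpose in that of `-H`.
  obtain ⟨h, hh⟩ := hne 3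
  have h1 : 0 - h ∈ Φ.S 3 := hsymm 3 h 0 (by simpa [GaloisPoly.rel] using hh)
  have h2 : 0 - h ∈ Φ.S 4 := by
    rw [zero_sub]
    exact Set.neg_mem_neg.mpr hh
  exact absurd (hdisj 3 4 _ h1 h2) (by decide)
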